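/- Let $M$ be a (Hausdorff) $C^\infty$ manifold of finite dimension $n$ and let $F:TM\to\mathbb R$ be a Finsler metric: $F$ is continuous, $C^\infty$ off the zero section, $F(x,X)>0$ for $X\neq 0$, $F(x,rX)=rF(x,X)$ for $r>0$, and for every $X\in T_xM\setminus\{0\}$ the metric tensor $g_{(x,X)}$, with components $g_{ij}=\frac12\frac{\partial^2F^2}{\partial X^i\partial X^j}(x,X)$, is positive definite on $T_xM$. A geodesic of $F$ is a smooth curve which satisfies, in charts, the Euler–Lagrange equations of the energy $L=\frac12F^2$ (constant curves are included). For $x\in M$ and $X\in T_xM$ let $c_X$ be the geodesic with $c_X(0)=x$ and $\dot c_X(0)=X$, and let $Exp_x(X)=c_X(1)$ whenever $c_X$ is defined on $[0,1]$. For $\varepsilon>0$ put $B_\varepsilon(0_x)=\{X\in T_xM : F(x,X)<\varepsilon\}$. **Proposition 2.7 (Finsler Gauss lemma).** Let $x\in M$, let $\varepsilon>0$ be such that $Exp_x$ is defined on $B_\varepsilon(0_x)$, and let $X\in B_\varepsilon(0_x)$. Then $Exp_x$ is differentiable at $X$ and, with $(DExp_x)_X:T_XT_xM=T_xM\to T_{Exp_x(X)}M$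 denoting its differential: (i) $F(x,X)=F\bigl(Exp_x(X),(DExp_x)_XX\bigr)$. (ii) For every $Y\in T_xM$ such that $g_{(x,X)}(X,Y)=0$, $$g_{(Exp_x(X),\,(DExp_x)_XX)}\bigl((DExp_x)_XX,\,(DExp_x)_XY\bigr)=0.$$ (For $X=0$, where the metric tensor is not defined, the two sides in (ii) are read as $0$.) -/

import Mathlib

open Set
open scoped Manifold ContDiff

noncomputable section

/-- A Finsler metric on a manifold `M` modelled on the finite dimensional space `E`: a continuous
function `F` on the tangent bundle, smooth off the zero section, positive off the zero section,
positively homogeneous of degree one on every fibre, and such that the Hessian of `F ^ 2 / 2` along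
the fibres is positive definite at every nonzero vector.  `TangentSpace 𝓘(ℝ, E) x` is `E` by
definition, so that the functions on `T_x M` are differentiated as functions on `E`. -/
structure FinslerMetric (E : Type*) [NormedAddCommGroup E] [NormedSpace ℝ E]
    (M : Type*) [TopologicalSpace M] [ChartedSpace E M] [IsManifold 𝓘(ℝ, E) ∞ M] where
  /-- The metric function `F (x, X)`. -/
  toFun : TangentBundle 𝓘(ℝ, E) M → ℝ
  continuous_toFun : Continuous toFun
  contMDiffOn_toFun :
    ContMDiffOn 𝓘(ℝ, E).tangent 𝓘(ℝ, ℝ) ∞ toFun {p : TangentBundle 𝓘(ℝ, E) M | p.2 ≠ 0}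
  pos : ∀ (x : M) (X : TangentSpace 𝓘(ℝ, E) x), X ≠ 0 → 0 < toFun ⟨x, X⟩
  homogeneous : ∀ (x : M) (X : TangentSpace 𝓘(ℝ, E) x) (r : ℝ), 0 < r →
    toFun ⟨x, r • X⟩ = r * toFun ⟨x, X⟩
  posDef : ∀ (x : M) (p Y : E), p ≠ 0 → Y ≠ 0 →
    0 < fderiv ℝ (fderiv ℝ (fun v : E => toFun ⟨x, v⟩ ^ 2 / 2)) p Y Y

namespace FinslerMetric

variable {E : Type*} [NormedAddCommGroup E] [NormedSpace ℝ E]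
  {M : Type*} [TopologicalSpace M] [ChartedSpace E M] [IsManifold 𝓘(ℝ, E) ∞ M]

instance : CoeFun (FinslerMetric E M) (fun _ => TangentBundle 𝓘(ℝ, E) M → ℝ) :=
  ⟨FinslerMetric.toFun⟩

/-- The metric tensor `g_(x,p)` of `F`, that is `g_ij = (1/2) ∂² F² / ∂X^i ∂X^j` at `(x, p)`.
(It is meaningful for `p ≠ 0`.) -/
def metricTensor (F : FinslerMetric E M) (x : M) (p : TangentSpace 𝓘(ℝ, E) x) :
    TangentSpace 𝓘(ℝ, E) x →L[ℝ] TangentSpace 𝓘(ℝ, E) x →L[ℝ] ℝ :=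
  fderiv ℝ (fderiv ℝ (fun v : E => F ⟨x, v⟩ ^ 2 / 2)) (p : E)

/-- The open indicatrix `B_ρ(0_x) = {X ∈ T_x M | F (x, X) < ρ}`. -/
def openIndicatrix (F : FinslerMetric E M) (x : M) (ρ : ℝ) : Set (TangentSpace 𝓘(ℝ, E) x) :=
  {X | F ⟨x, X⟩ < ρ}

/-- The energy Lagrangian `F ^ 2 / 2` in the chart of the tangent bundle which is induced by the
preferred chart of `M` at `a`; the arguments are the position `u` and the velocity `v`. -/
def localEnergy (F : FinslerMetric E M) (a : M) (u v : E) : ℝ :=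
  F ((extChartAt 𝓘(ℝ, E).tangent (⟨a, 0⟩ : TangentBundle 𝓘(ℝ, E) M)).symm (u, v)) ^ 2 / 2

/-- The velocity lift `t ↦ (c t, c' t)` of a curve of `M` to the tangent bundle. -/
def velocityLift (c : ℝ → M) (t : ℝ) : TangentBundle 𝓘(ℝ, E) M :=
  ⟨c t, mfderiv 𝓘(ℝ, ℝ) 𝓘(ℝ, E) c t (1 : ℝ)⟩

/-- `c` is a geodesic of `F` on the open set `s` of times: it is smooth and, in charts, it
satisfies the Euler-Lagrange equations `d/dt (∂L/∂v (u, u')) = ∂L/∂u (u, u')` of the energy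
`L = F ^ 2 / 2`, where `u` is the coordinate expression of `c`. -/
structure IsGeodesicOn (F : FinslerMetric E M) (c : ℝ → M) (s : Set ℝ) : Prop where
  smooth : ContMDiffOn 𝓘(ℝ, ℝ) 𝓘(ℝ, E) ∞ c s
  eulerLagrange : ∀ (a : M), ∀ t ∈ s, c t ∈ (extChartAt 𝓘(ℝ, E) a).source →
    let u : ℝ → E := fun τ => extChartAt 𝓘(ℝ, E) a (c τ)
    HasDerivAt (fun τ => fderiv ℝ (fun v => F.localEnergy a (u τ) v) (deriv u τ))
      (fderiv ℝ (fun w => F.localEnergy a w (deriv u t)) (u t)) t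

/-- `c` is a geodesic of `F`, defined on an open interval containing `[0, 1]`, with initial
conditions `c 0 = x` and `c' 0 = X`. -/
def IsUnitTimeGeodesic (F : FinslerMetric E M) (x : M) (X : TangentSpace 𝓘(ℝ, E) x)
    (c : ℝ → M) : Prop :=
  (∃ δ > 0, F.IsGeodesicOn c (Ioo (-δ) (1 + δ))) ∧
    velocityLift c 0 = (⟨x, X⟩ : TangentBundle 𝓘(ℝ, E) M)

/-- The set of the vectors `X ∈ T_x M` at which the exponential map is defined, that is whose
geodesic is defined at least up to time one. -/
def expDomain (F : FinslerMetric E M) (x : M) : Set (TangentSpace 𝓘(ℝ, E) x) :=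
  {X | ∃ c : ℝ → M, F.IsUnitTimeGeodesic x X c}

open Classical in
/-- The exponential map `Exp_x X = c_X 1`, where `c_X` is the geodesic of `F` with `c_X 0 = x` and
`c_X' 0 = X`.  The value outside `expDomain` is irrelevant. -/
def exp (F : FinslerMetric E M) (x : M) (X : E) : M :=
  if h : ∃ c : ℝ → M, F.IsUnitTimeGeodesic x X c then h.choose 1 else x

/-- The differential `(D Exp_x)_X : T_x M = T_X T_x M → T_(Exp_x X) M`. -/
def dexp (F : FinslerMetric E M) (x : M) (X : TangentSpace 𝓘(ℝ, E) x) :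
    TangentSpace 𝓘(ℝ, E) x →L[ℝ] TangentSpace 𝓘(ℝ, E) (F.exp x X) :=
  mfderiv 𝓘(ℝ, E) 𝓘(ℝ, E) (F.exp x) (X : E)

end FinslerMetric

end

/-! The Gauss lemma is the first variation formula for the energy L = F²/2. Let e(Y) = F(x, Y)²/2 on
T_xM, and let c_Y be the geodesic with initial velocity Y. In a chart, a geodesic of nonzero speed
is an integral curve of the `spray`; along it L is constant and the momentum p = ∂L/∂v changes at
the rate ∂L/∂u. If the geodesic c_X is varied in the direction q, the pairing of p with the
variation field therefore has as time derivative the variation of L, and conservation of energy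
identifies this with the constant de_X(q). The pairing vanishes at time 0, because all geodesics
start at x. At time 1 it says that the fibre differential of the energy at c_X'(1), applied to DExp
q, equals de_X(q). By Euler's relation the two differentials are g(c_X'(1), ·) and g(X, ·)
(`metricTensor_self`), and DExp X = c_X'(1) (`dexp_self`). This gives (ii), while (i) is
conservation of speed.

The analytic work is the differentiability of c_Y'(t) in Y. Over a short time and inside one chart
it follows from the linearized equation and Gronwall's inequality (`differentiableAt_of_ode`), and
`momentum_variation` derives the variation formula from finite differences, so that mixed
derivatives in time and parameter never occur. `exists_forward_propagation` transports both facts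
over a short time, and `unitInterval_forward_induction` carries them from 0 to 1; the chart-free
`velocityPairing` glues the pieces.

The spray is controlled only off the zero section, since F² need not be C² there. Constancy of speed
keeps nonconstant geodesics away from it. The vector X = 0 is treated apart: by
`exists_norm_extChartAt_geodesic_sub_le`, Exp agrees in a chart with a translation up to a quadratic
error. -/

/-! ### Differentiable dependence of solutions of autonomous ODEs on the initial value -/

section ODEDependence

open Metric Filter
open scoped Topology NNReal

variable {Z W P : Type*} [NormedAddCommGroup Z] [NormedSpace ℝ Z] [NormedAddCommGroup W]
  [NormedSpace ℝ W] [NormedAddCommGroup P] [NormedSpace ℝ P]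

/-- A `C¹` function is uniformly differentiable on compact balls. -/
theorem exists_norm_image_sub_sub_fderiv_le [ProperSpace Z] {f : Z → W} {z₀ : Z} {r : ℝ}
    (hf : ∀ z ∈ closedBall z₀ r, ContDiffAt ℝ 1 f z) {η : ℝ} (hη : 0 < η) :
    ∃ ρ > 0, ∀ a ∈ closedBall z₀ r, ∀ b ∈ closedBall z₀ r, ‖b - a‖ < ρ →
      ‖f b - f a - fderiv ℝ f a (b - a)‖ ≤ η * ‖b - a‖ := by
  have hcont : ContinuousOn (fderiv ℝ f) (closedBall z₀ r) := fun z hz =>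
    ((hf z hz).continuousAt_fderiv one_ne_zero).continuousWithinAt
  have huc := (isCompact_closedBall z₀ r).uniformContinuousOn_of_continuous hcont
  obtain ⟨ρ, hρ, h⟩ := Metric.uniformContinuousOn_iff.1 huc η hη
  refine ⟨ρ, hρ, fun a ha b hb hab => ?_⟩
  have hab' : b ∈ closedBall z₀ r ∩ ball a ρ := ⟨hb, by rwa [mem_ball, dist_eq_norm]⟩
  refine Convex.norm_image_sub_le_of_norm_hasFDerivWithin_le' (𝕜 := ℝ)
    (s := closedBall z₀ r ∩ ball a ρ) (f' := fderiv ℝ f)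
    (fun z hz => ((hf z hz.1).differentiableAt one_ne_zero).hasFDerivAt.hasFDerivWithinAt)
    (fun z hz => ?_) ((convex_closedBall _ _).inter (convex_ball _ _))
    ⟨ha, mem_ball_self hρ⟩ hab'
  rw [← dist_eq_norm]
  exact (h z hz.1 a ha hz.2).le

/-- Linear differential equations are solvable over short time intervals. -/
theorem exists_fundamental_solution [CompleteSpace Z] {A : ℝ → Z →L[ℝ] Z} {t₁ t₂ : ℝ} {K : ℝ≥0}
    (hA : ContinuousOn A (Icc t₁ t₂)) (hK : ∀ t ∈ Icc t₁ t₂, ‖A t‖ ≤ K) (ht : t₁ ≤ t₂)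
    (hKt : K * (t₂ - t₁) ≤ 1 / 2) :
    ∃ V : ℝ → Z →L[ℝ] Z, V t₁ = ContinuousLinearMap.id ℝ Z ∧
      ∀ t ∈ Icc t₁ t₂, HasDerivWithinAt V ((A t).comp (V t)) (Icc t₁ t₂) t := by
  -- On the unit ball around the identity ‖V‖ ≤ 2, so the field is bounded by 2K; as 2K(t₂ - t₁) ≤
  -- 1, solutions do not leave this ball.
  have hPL : IsPicardLindelof (fun t V => (A t).comp V) (⟨t₁, left_mem_Icc.2 ht⟩ : Icc t₁ t₂)
      (ContinuousLinearMap.id ℝ Z) 1 0 (2 * K) K := by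
    refine ⟨fun t ht => LipschitzOnWith.of_dist_le_mul fun V _ V' _ => ?_, fun V _ => hA.clm_comp continuousOn_const,
      fun t ht V hV => ?_, ?_⟩
    · rw [dist_eq_norm, dist_eq_norm, ← ContinuousLinearMap.comp_sub]
      exact (ContinuousLinearMap.opNorm_comp_le _ _).trans
        (mul_le_mul_of_nonneg_right (hK t ht) (norm_nonneg _))
    · have hV' : ‖V‖ ≤ 2 := by
        have h1 : ‖V - ContinuousLinearMap.id ℝ Z‖ ≤ 1 := by
          simpa [mem_closedBall, dist_eq_norm] using hV
        have h2 := norm_add_le (V - ContinuousLinearMap.id ℝ Z) (ContinuousLinearMap.id ℝ Z)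
        rw [sub_add_cancel] at h2
        linarith [ContinuousLinearMap.norm_id_le (𝕜 := ℝ) (E := Z)]
      calc ‖(A t).comp V‖ ≤ ‖A t‖ * ‖V‖ := ContinuousLinearMap.opNorm_comp_le _ _
        _ ≤ K * 2 := mul_le_mul (hK t ht) hV' (norm_nonneg _) K.2
        _ = ((2 * K : ℝ≥0) : ℝ) := by push_cast; ring
    · have : max (t₂ - t₁) (t₁ - t₁) = t₂ - t₁ := by rw [max_eq_left]; linarith
      simp only [this]
      push_cast
      linarith
  exact hPL.exists_eq_forall_mem_Icc_hasDerivWithinAt₀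

theorem lipschitzOnWith_closedBall_of_norm_fderiv_le {f : Z → Z} {z₀ : Z} {r : ℝ} {K : ℝ≥0}
    (hf : ∀ z ∈ closedBall z₀ r, ContDiffAt ℝ 1 f z)
    (hK : ∀ z ∈ closedBall z₀ r, ‖fderiv ℝ f z‖ ≤ K) : LipschitzOnWith K f (closedBall z₀ r) :=
  Convex.lipschitzOnWith_of_nnnorm_fderiv_le (𝕜 := ℝ)
    (fun z hz => (hf z hz).differentiableAt one_ne_zero) (fun z hz => hK z hz)
    (convex_closedBall _ _)

/-- Solutions of an ODE depend in a locally Lipschitz way on a parameter, if their initial values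
do. -/
theorem exists_norm_sub_le_of_ode {f : Z → Z} {z₀ : Z} {r : ℝ} {K : ℝ≥0}
    (hf : ∀ z ∈ closedBall z₀ r, ContDiffAt ℝ 1 f z)
    (hK : ∀ z ∈ closedBall z₀ r, ‖fderiv ℝ f z‖ ≤ K) {z : P → ℝ → Z} {p₀ : P} {t₁ t₂ : ℝ}
    (hz : ∀ᶠ p in 𝓝 p₀, ∀ t ∈ Icc t₁ t₂, z p t ∈ closedBall z₀ r ∧
      HasDerivAt (z p) (f (z p t)) t)
    (hd : DifferentiableAt ℝ (fun p => z p t₁) p₀) :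
    ∃ C > 0, ∀ᶠ p in 𝓝 p₀, ∀ t ∈ Icc t₁ t₂, ‖z p t - z p₀ t‖ ≤ C * ‖p - p₀‖ := by
  obtain ⟨c, hc⟩ := hd.isBigO_sub.bound
  -- The big-O constant c may be negative or zero; |c| + 1 is a positive substitute.
  refine ⟨(|c| + 1) * Real.exp (K * (t₂ - t₁)), by positivity, ?_⟩
  have hz₀ := hz.self_of_nhds
  filter_upwards [hz, hc] with p hp hpc t htt
  have := dist_le_of_trajectories_ODE_of_mem (v := fun _ => f) (s := fun _ => closedBall z₀ r)
    (K := K) (a := t₁) (b := t₂) (f := z p) (g := z p₀) (δ := (|c| + 1) * ‖p - p₀‖)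
    (fun _ _ => lipschitzOnWith_closedBall_of_norm_fderiv_le hf hK)
    (HasDerivAt.continuousOn fun t ht => (hp t ht).2)
    (fun t ht => (hp t (Ico_subset_Icc_self ht)).2.hasDerivWithinAt)
    (fun t ht => (hp t (Ico_subset_Icc_self ht)).1)
    (HasDerivAt.continuousOn fun t ht => (hz₀ t ht).2)
    (fun t ht => (hz₀ t (Ico_subset_Icc_self ht)).2.hasDerivWithinAt)
    (fun t ht => (hz₀ t (Ico_subset_Icc_self ht)).1)
    (by
      rw [dist_eq_norm]
      exact hpc.trans (mul_le_mul_of_nonneg_right (by linarith [le_abs_self c]) (norm_nonneg _)))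
    t htt
  rw [dist_eq_norm] at this
  refine this.trans ?_
  have h1 : Real.exp (K * (t - t₁)) ≤ Real.exp (K * (t₂ - t₁)) := by
    gcongr
    exact htt.2
  calc (|c| + 1) * ‖p - p₀‖ * Real.exp (K * (t - t₁))
      ≤ (|c| + 1) * ‖p - p₀‖ * Real.exp (K * (t₂ - t₁)) := by gcongr
    _ = _ := by ring

/-- Solutions of an ODE depend differentiably on a parameter, if their initial values do. -/
theorem differentiableAt_of_ode [FiniteDimensional ℝ Z] {f : Z → Z} {z₀ : Z} {r : ℝ} {K : ℝ≥0}
    (hf : ∀ z ∈ closedBall z₀ r, ContDiffAt ℝ 1 f z)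
    (hK : ∀ z ∈ closedBall z₀ r, ‖fderiv ℝ f z‖ ≤ K) {z : P → ℝ → Z} {p₀ : P} {t₁ t₂ : ℝ}
    (ht : t₁ ≤ t₂) (hKt : K * (t₂ - t₁) ≤ 1 / 2)
    (hz : ∀ᶠ p in 𝓝 p₀, ∀ t ∈ Icc t₁ t₂, z p t ∈ closedBall z₀ r ∧
      HasDerivAt (z p) (f (z p t)) t)
    (hd : DifferentiableAt ℝ (fun p => z p t₁) p₀) :
    DifferentiableAt ℝ (fun p => z p t₂) p₀ := by
  have : ProperSpace Z := FiniteDimensional.proper ℝ Z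
  have : CompleteSpace Z := FiniteDimensional.complete ℝ Z
  have hz₀ := hz.self_of_nhds
  obtain ⟨C, hC0, hC⟩ := exists_norm_sub_le_of_ode hf hK hz hd
  obtain ⟨D, hD⟩ := hd
  have hzcont : ContinuousOn (z p₀) (Icc t₁ t₂) := HasDerivAt.continuousOn fun t ht => (hz₀ t ht).2
  have hA : ContinuousOn (fun t => fderiv ℝ f (z p₀ t)) (Icc t₁ t₂) := fun t ht =>
    ContinuousAt.comp_continuousWithinAt
      ((hf _ (hz₀ t ht).1).continuousAt_fderiv one_ne_zero) (hzcont t ht)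
  obtain ⟨V, hV1, hV⟩ := exists_fundamental_solution hA (fun t ht => hK _ (hz₀ t ht).1) ht hKt
  refine ⟨(V t₂).comp D, ?_⟩
  -- `gronwallBound` is jointly linear in the initial error and the inhomogeneity. Both will be e' *
  -- ‖p - p₀‖, so the final error is that multiple of M, and e' = e / M gives e.
  set M : ℝ := gronwallBound 1 K 1 (t₂ - t₁) with hM
  rw [hasFDerivAt_iff_isLittleO]
  have hD' := hasFDerivAt_iff_isLittleO.1 hD
  rw [Asymptotics.isLittleO_iff]
  intro e he
  have hMpos : 0 < M := by
    have := gronwallBound_mono (δ := 1) (K := (K : ℝ)) (ε := 1) zero_le_one zero_le_one K.2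
      (show (0 : ℝ) ≤ t₂ - t₁ by linarith)
    rw [gronwallBound_x0] at this
    linarith
  set e' := e / M with he'
  have he'0 : 0 < e' := by positivity
  obtain ⟨ρ, hρ, hunif⟩ := exists_norm_image_sub_sub_fderiv_le hf (η := e' / C) (by positivity)
  have hsmall : ∀ᶠ p in 𝓝 p₀, C * ‖p - p₀‖ < ρ := by
    have : Tendsto (fun p => C * ‖p - p₀‖) (𝓝 p₀) (𝓝 (C * ‖p₀ - p₀‖)) :=
      (Continuous.tendsto (by fun_prop) p₀)
    rw [sub_self, norm_zero, mul_zero] at this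
    exact this.eventually (gt_mem_nhds hρ)
  filter_upwards [hz, hC, hsmall, (Asymptotics.isLittleO_iff.1 hD') he'0] with p hp hpC hps hp1
  have hW : ∀ t ∈ Icc t₁ t₂, HasDerivWithinAt (fun t => z p t - z p₀ t - V t (D (p - p₀)))
      (f (z p t) - f (z p₀ t) - ((fderiv ℝ f (z p₀ t)).comp (V t)) (D (p - p₀)))
      (Icc t₁ t₂) t := fun t ht =>
    (((hp t ht).2.hasDerivWithinAt.sub (hz₀ t ht).2.hasDerivWithinAt).sub
      ((ContinuousLinearMap.apply ℝ Z (D (p - p₀))).hasFDerivAt.comp_hasDerivWithinAt t (hV t ht)))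
  have key := norm_le_gronwallBound_of_norm_deriv_right_le (K := K)
    (δ := e' * ‖p - p₀‖) (ε := e' * ‖p - p₀‖) (a := t₁) (b := t₂)
    (f := fun t => z p t - z p₀ t - V t (D (p - p₀)))
    (f' := fun t => f (z p t) - f (z p₀ t) - ((fderiv ℝ f (z p₀ t)).comp (V t)) (D (p - p₀)))
    (fun t ht => (hW t ht).continuousWithinAt)
    (fun t ht => (hW t (Ico_subset_Icc_self ht)).mono_of_mem_nhdsWithin
      (Icc_mem_nhdsGE_of_mem ht))
    (by simpa [hV1] using hp1)
    (fun t ht => by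
      have htt := Ico_subset_Icc_self ht
      have h1 := hunif _ (hz₀ t htt).1 _ (hp t htt).1 ((hpC t htt).trans_lt hps)
      -- The derivative of the error splits into the linearized field applied to the error, bounded
      -- through K, and a Taylor remainder of f, which is small uniformly in t.
      have h2 : f (z p t) - f (z p₀ t) - ((fderiv ℝ f (z p₀ t)).comp (V t)) (D (p - p₀)) =
        fderiv ℝ f (z p₀ t) (z p t - z p₀ t - V t (D (p - p₀))) +
          (f (z p t) - f (z p₀ t) - fderiv ℝ f (z p₀ t) (z p t - z p₀ t)) := by
        simp only [map_sub, ContinuousLinearMap.comp_apply]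
        abel
      rw [h2]
      refine (norm_add_le _ _).trans (add_le_add ?_ (h1.trans ?_))
      · exact ((fderiv ℝ f (z p₀ t)).le_opNorm _).trans
          (mul_le_mul_of_nonneg_right (hK _ (hz₀ t htt).1) (norm_nonneg _))
      · calc e' / C * ‖z p t - z p₀ t‖ ≤ e' / C * (C * ‖p - p₀‖) := by
              gcongr
              exact hpC t htt
          _ = e' * ‖p - p₀‖ := by field_simp)
    t₂ (right_mem_Icc.2 ht)
  have hscale : gronwallBound (e' * ‖p - p₀‖) K (e' * ‖p - p₀‖) (t₂ - t₁) =
      e' * ‖p - p₀‖ * M := by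
    rw [hM]
    by_cases hK0 : (K : ℝ) = 0
    · simp only [hK0, gronwallBound_K0]; ring
    · simp only [gronwallBound_of_K_ne_0 hK0]; ring
  rw [hscale] at key
  calc _ ≤ e' * ‖p - p₀‖ * M := key
    _ = e * ‖p - p₀‖ := by rw [he']; field_simp

end ODEDependence

/-! ### Homogeneous Lagrangians of degree two -/

section Homogeneous

open Filter
open scoped Topology

variable {E : Type*} [NormedAddCommGroup E] [NormedSpace ℝ E]

/-- Differentiating G(rv) = r²G(v) in v and cancelling one factor r suffices. No differentiability
is needed, since scaling commutes with `fderiv` unconditionally. -/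
theorem fderiv_smul_of_homogeneous {G : E → ℝ} (hG : ∀ r : ℝ, 0 < r → ∀ v, G (r • v) = r ^ 2 * G v)
    {r : ℝ} (hr : 0 < r) (v : E) : fderiv ℝ G (r • v) = r • fderiv ℝ G v := by
  have h1 : (fun w => G (r • w)) = r ^ 2 • G := funext fun w => hG r hr w
  have h2 := congrArg (fun g => fderiv ℝ g v) h1
  simp only [fderiv_comp_smul, fderiv_const_smul_field] at h2
  rw [pow_two, mul_smul] at h2
  exact smul_right_injective _ hr.ne' h2

theorem hasDerivAt_smul_const (v : E) : HasDerivAt (fun r : ℝ => r • v) v 1 := by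
  simpa using (hasDerivAt_id (1 : ℝ)).smul_const v

/-- Euler's relation in degree two: differentiate r ↦ G(rv) at r = 1. The next theorem but one is
the same relation in degree one, for the differential of G. -/
theorem fderiv_self_of_homogeneous {G : E → ℝ}
    (hG : ∀ r : ℝ, 0 < r → ∀ v, G (r • v) = r ^ 2 * G v) {v : E} (hd : DifferentiableAt ℝ G v) :
    fderiv ℝ G v v = 2 * G v := by
  have h1 : HasDerivAt (fun r : ℝ => G (r • v)) (fderiv ℝ G v v) 1 := by
    have : HasFDerivAt G (fderiv ℝ G v) ((1 : ℝ) • v) := by rw [one_smul]; exact hd.hasFDerivAt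
    exact this.comp_hasDerivAt 1 (hasDerivAt_smul_const v)
  have h2 : HasDerivAt (fun r : ℝ => r ^ 2 * G v) (2 * G v) 1 := by
    simpa using (hasDerivAt_pow 2 (1 : ℝ)).mul_const (G v)
  refine h1.unique (h2.congr_of_eventuallyEq ?_)
  filter_upwards [lt_mem_nhds (zero_lt_one (α := ℝ))] with r hr using hG r hr v

theorem fderiv_fderiv_self_of_homogeneous {G : E → ℝ}
    (hG : ∀ r : ℝ, 0 < r → ∀ v, G (r • v) = r ^ 2 * G v) {v : E}
    (hd : DifferentiableAt ℝ (fderiv ℝ G) v) :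
    fderiv ℝ (fderiv ℝ G) v v = fderiv ℝ G v := by
  have h1 : HasDerivAt (fun r : ℝ => fderiv ℝ G (r • v)) (fderiv ℝ (fderiv ℝ G) v v) 1 := by
    have : HasFDerivAt (fderiv ℝ G) (fderiv ℝ (fderiv ℝ G) v) ((1 : ℝ) • v) := by
      rw [one_smul]; exact hd.hasFDerivAt
    exact this.comp_hasDerivAt 1 (hasDerivAt_smul_const v)
  refine h1.unique ((hasDerivAt_smul_const (fderiv ℝ G v)).congr_of_eventuallyEq ?_)
  filter_upwards [lt_mem_nhds (zero_lt_one (α := ℝ))] with r hr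
    using fderiv_smul_of_homogeneous hG hr v

/-- A Finsler energy `L (u, v)` on an open subset `U` of a vector space. -/
structure IsChartEnergy (U : Set E) (L : E → E → ℝ) : Prop where
  isOpen : IsOpen U
  contDiffOn : ContDiffOn ℝ ∞ (Function.uncurry L) (U ×ˢ {0}ᶜ)
  homogeneous : ∀ u ∈ U, ∀ r : ℝ, 0 < r → ∀ v, L u (r • v) = r ^ 2 * L u v
  posDef : ∀ u ∈ U, ∀ v w : E, v ≠ 0 → w ≠ 0 → 0 < fderiv ℝ (fderiv ℝ (L u)) v w w
  pos : ∀ u ∈ U, ∀ v, v ≠ 0 → 0 < L u v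

/-- The derivative of a Lagrangian with respect to the velocity. -/
noncomputable def momentum (L : E → E → ℝ) (z : E × E) : E →L[ℝ] ℝ :=
  (fderiv ℝ (Function.uncurry L) z).comp (ContinuousLinearMap.inr ℝ E E)

/-- The derivative of a Lagrangian with respect to the position. -/
noncomputable def force (L : E → E → ℝ) (z : E × E) : E →L[ℝ] ℝ :=
  (fderiv ℝ (Function.uncurry L) z).comp (ContinuousLinearMap.inl ℝ E E)

/-- The Hessian of a Lagrangian with respect to the velocity. -/
noncomputable def fiberHessian (L : E → E → ℝ) (z : E × E) : E →L[ℝ] E →L[ℝ] ℝ :=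
  (fderiv ℝ (momentum L) z).comp (ContinuousLinearMap.inr ℝ E E)

/-- The vector field on the phase space whose integral curves solve the Euler-Lagrange
equations. -/
noncomputable def spray (L : E → E → ℝ) (z : E × E) : E × E :=
  (z.2, (fiberHessian L z).inverse (force L z - fderiv ℝ (momentum L) z (z.2, 0)))

namespace IsChartEnergy

variable {U : Set E} {L : E → E → ℝ} {z : E × E}

theorem isOpen_prod (h : IsChartEnergy U L) : IsOpen (U ×ˢ ({0}ᶜ : Set E)) :=
  h.isOpen.prod isOpen_compl_singleton

theorem contDiffAt (h : IsChartEnergy U L) (hz : z ∈ U ×ˢ ({0}ᶜ : Set E)) :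
    ContDiffAt ℝ ∞ (Function.uncurry L) z :=
  h.contDiffOn.contDiffAt (h.isOpen_prod.mem_nhds hz)

theorem differentiableAt (h : IsChartEnergy U L) (hz : z ∈ U ×ˢ ({0}ᶜ : Set E)) :
    DifferentiableAt ℝ (Function.uncurry L) z :=
  (h.contDiffAt hz).differentiableAt (by simp)

theorem contDiffAt_fderiv (h : IsChartEnergy U L) (hz : z ∈ U ×ˢ ({0}ᶜ : Set E)) :
    ContDiffAt ℝ ∞ (fderiv ℝ (Function.uncurry L)) z :=
  (h.contDiffAt hz).fderiv_right (by norm_cast)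

theorem contDiffAt_momentum (h : IsChartEnergy U L) (hz : z ∈ U ×ˢ ({0}ᶜ : Set E)) :
    ContDiffAt ℝ ∞ (momentum L) z :=
  (h.contDiffAt_fderiv hz).clm_comp contDiffAt_const

theorem contDiffAt_force (h : IsChartEnergy U L) (hz : z ∈ U ×ˢ ({0}ᶜ : Set E)) :
    ContDiffAt ℝ ∞ (force L) z :=
  (h.contDiffAt_fderiv hz).clm_comp contDiffAt_const

theorem contDiffAt_fiberHessian (h : IsChartEnergy U L) (hz : z ∈ U ×ˢ ({0}ᶜ : Set E)) :
    ContDiffAt ℝ ∞ (fiberHessian L) z :=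
  ((h.contDiffAt_momentum hz).fderiv_right (by norm_cast)).clm_comp contDiffAt_const

theorem hasFDerivAt_velocity (h : IsChartEnergy U L) (hz : z ∈ U ×ˢ ({0}ᶜ : Set E)) :
    HasFDerivAt (L z.1) (momentum L z) z.2 :=
  HasFDerivAt.comp (g := Function.uncurry L) (f := fun v => (z.1, v)) z.2
    (h.differentiableAt hz).hasFDerivAt (hasFDerivAt_prodMk_right z.1 z.2)

theorem momentum_eq (h : IsChartEnergy U L) (hz : z ∈ U ×ˢ ({0}ᶜ : Set E)) :
    momentum L z = fderiv ℝ (L z.1) z.2 :=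
  (h.hasFDerivAt_velocity hz).fderiv.symm

theorem force_eq (h : IsChartEnergy U L) (hz : z ∈ U ×ˢ ({0}ᶜ : Set E)) :
    force L z = fderiv ℝ (fun w => L w z.2) z.1 :=
  (HasFDerivAt.fderiv (HasFDerivAt.comp (g := Function.uncurry L) (f := fun w => (w, z.2)) z.1
    (h.differentiableAt hz).hasFDerivAt (hasFDerivAt_prodMk_left z.1 z.2))).symm

theorem fiberHessian_eq (h : IsChartEnergy U L) (hz : z ∈ U ×ˢ ({0}ᶜ : Set E)) :
    fiberHessian L z = fderiv ℝ (fderiv ℝ (L z.1)) z.2 := by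
  have h1 : HasFDerivAt (fun v => momentum L (z.1, v)) (fiberHessian L z) z.2 :=
    HasFDerivAt.comp (g := momentum L) (f := fun v => (z.1, v)) z.2
      ((h.contDiffAt_momentum hz).differentiableAt (by simp)).hasFDerivAt
      (hasFDerivAt_prodMk_right z.1 z.2)
  refine ((h1.congr_of_eventuallyEq ?_).fderiv).symm
  filter_upwards [isOpen_compl_singleton.mem_nhds hz.2] with v hv
  exact (h.momentum_eq (z := (z.1, v)) ⟨hz.1, hv⟩).symm

theorem momentum_self (h : IsChartEnergy U L) (hz : z ∈ U ×ˢ ({0}ᶜ : Set E)) :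
    momentum L z z.2 = 2 * L z.1 z.2 := by
  rw [h.momentum_eq hz]
  exact fderiv_self_of_homogeneous (h.homogeneous z.1 hz.1)
    (h.hasFDerivAt_velocity hz).differentiableAt

variable [FiniteDimensional ℝ E]

/-- A positive definite form has trivial kernel, and E and its dual have the same finite dimension.
This allows the Euler-Lagrange equations to be solved for the acceleration. -/
theorem exists_fiberHessian_equiv (h : IsChartEnergy U L) (hz : z ∈ U ×ˢ ({0}ᶜ : Set E)) :
    ∃ e : E ≃L[ℝ] (E →L[ℝ] ℝ), (e : E →L[ℝ] E →L[ℝ] ℝ) = fiberHessian L z := by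
  have hinj : Function.Injective (fiberHessian L z).toLinearMap := by
    rw [← LinearMap.ker_eq_bot, LinearMap.ker_eq_bot']
    intro w hw
    by_contra hw0
    have := h.posDef z.1 hz.1 z.2 w hz.2 hw0
    rw [← h.fiberHessian_eq hz] at this
    have hw' : fiberHessian L z w = 0 := hw
    simp [hw'] at this
  have hdim : Module.finrank ℝ E = Module.finrank ℝ (E →L[ℝ] ℝ) := by
    rw [← (LinearMap.toContinuousLinearMap (𝕜 := ℝ) (E := E) (F' := ℝ)).finrank_eq]
    exact Subspace.dual_finrank_eq.symm
  refine ⟨(LinearEquiv.ofInjectiveOfFinrankEq _ hinj hdim).toContinuousLinearEquiv, ?_⟩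
  ext v w
  rfl

theorem fiberHessian_inverse (h : IsChartEnergy U L) (hz : z ∈ U ×ˢ ({0}ᶜ : Set E))
    (β : E →L[ℝ] ℝ) : fiberHessian L z ((fiberHessian L z).inverse β) = β := by
  obtain ⟨e, he⟩ := h.exists_fiberHessian_equiv hz
  rw [← he, ContinuousLinearMap.inverse_equiv]
  exact e.apply_symm_apply β

theorem inverse_fiberHessian (h : IsChartEnergy U L) (hz : z ∈ U ×ˢ ({0}ᶜ : Set E))
    (a : E) : (fiberHessian L z).inverse (fiberHessian L z a) = a := by
  obtain ⟨e, he⟩ := h.exists_fiberHessian_equiv hz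
  rw [← he, ContinuousLinearMap.inverse_equiv]
  exact e.symm_apply_apply a

theorem contDiffAt_spray (h : IsChartEnergy U L) (hz : z ∈ U ×ˢ ({0}ᶜ : Set E)) :
    ContDiffAt ℝ 1 (spray L) z := by
  have : CompleteSpace E := FiniteDimensional.complete ℝ E
  obtain ⟨e, he⟩ := h.exists_fiberHessian_equiv hz
  have hinv : ContDiffAt ℝ ∞ (fun z => (fiberHessian L z).inverse) z := by
    have h1 := contDiffAt_map_inverse (n := ∞) (𝕜 := ℝ) e
    rw [he] at h1
    exact h1.comp z (h.contDiffAt_fiberHessian hz)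
  have hm : ContDiffAt ℝ ∞ (fderiv ℝ (momentum L)) z :=
    (h.contDiffAt_momentum hz).fderiv_right (by norm_cast)
  have h2 : ContDiffAt ℝ ∞ (spray L) z :=
    contDiffAt_snd.prodMk (hinv.clm_apply ((h.contDiffAt_force hz).sub
      (hm.clm_apply (contDiffAt_snd.prodMk contDiffAt_const))))
  exact h2.of_le (by norm_cast)

/-- The momentum changes at the rate given by the force along the spray. -/
theorem fderiv_momentum_spray (h : IsChartEnergy U L) (hz : z ∈ U ×ˢ ({0}ᶜ : Set E)) :
    fderiv ℝ (momentum L) z (spray L z) = force L z := by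
  have h1 : spray L z = (z.2, 0) + ContinuousLinearMap.inr ℝ E E (spray L z).2 := by
    simp [spray]
  rw [h1, map_add]
  have h2 : fderiv ℝ (momentum L) z (ContinuousLinearMap.inr ℝ E E (spray L z).2) =
      fiberHessian L z (spray L z).2 := rfl
  rw [h2, spray, h.fiberHessian_inverse hz]
  simp

/-- The energy is constant along the spray. -/
theorem fderiv_spray (h : IsChartEnergy U L) (hz : z ∈ U ×ˢ ({0}ᶜ : Set E)) :
    fderiv ℝ (Function.uncurry L) z (spray L z) = 0 := by
  -- Euler's relation p(v) = 2L, differentiated along the spray, gives p(a) + f(v) = 2 dL(spray),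
  -- with a the acceleration and f the force. The chain rule gives dL(spray) = f(v) + p(a). Hence
  -- dL(spray) = 2 dL(spray) = 0.
  have h1 : HasFDerivAt (fun y => momentum L y y.2) ((momentum L z).comp
      (ContinuousLinearMap.snd ℝ E E) + (fderiv ℝ (momentum L) z).flip z.2) z :=
    ((h.contDiffAt_momentum hz).differentiableAt (by simp)).hasFDerivAt.clm_apply hasFDerivAt_snd
  have h2 : HasFDerivAt (fun y => 2 * Function.uncurry L y)
      ((2 : ℝ) • fderiv ℝ (Function.uncurry L) z) z :=
    (h.differentiableAt hz).hasFDerivAt.const_mul 2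
  have h3 : (fun y => momentum L y y.2) =ᶠ[𝓝 z] fun y => 2 * Function.uncurry L y := by
    filter_upwards [h.isOpen_prod.mem_nhds hz] with y hy using h.momentum_self hy
  have h4 := congrArg (fun T => T (spray L z)) (h1.unique (h2.congr_of_eventuallyEq h3))
  simp only [add_apply, ContinuousLinearMap.comp_apply,
    ContinuousLinearMap.flip_apply, h.fderiv_momentum_spray hz, FunLike.coe_smul,
    Pi.smul_apply, smul_eq_mul, ContinuousLinearMap.coe_snd'] at h4
  have h5 : fderiv ℝ (Function.uncurry L) z (spray L z) =
      force L z z.2 + momentum L z (spray L z).2 := by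
    simp only [force, momentum, ContinuousLinearMap.comp_apply, ← map_add]
    congr 1
    simp [spray]
  linarith

/-- Solutions of the Euler-Lagrange equations are integral curves of the spray. -/
theorem hasDerivAt_spray (h : IsChartEnergy U L) {u : ℝ → E} {t : ℝ} (hu : u t ∈ U)
    (hu' : deriv u t ≠ 0) (hd : DifferentiableAt ℝ u t) (hd' : DifferentiableAt ℝ (deriv u) t)
    (hEL : HasDerivAt (fun τ => fderiv ℝ (L (u τ)) (deriv u τ))
      (fderiv ℝ (fun w => L w (deriv u t)) (u t)) t) :
    HasDerivAt (fun τ => (u τ, deriv u τ)) (spray L (u t, deriv u t)) t := by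
  have hz : (u t, deriv u t) ∈ U ×ˢ ({0}ᶜ : Set E) := ⟨hu, hu'⟩
  have h1 : HasDerivAt (fun τ => (u τ, deriv u τ)) (deriv u t, deriv (deriv u) t) t :=
    hd.hasDerivAt.prodMk hd'.hasDerivAt
  have h2 : HasDerivAt (fun τ => momentum L (u τ, deriv u τ))
      (fderiv ℝ (momentum L) (u t, deriv u t) (deriv u t, deriv (deriv u) t)) t :=
    HasFDerivAt.comp_hasDerivAt (l := momentum L) (f := fun τ => (u τ, deriv u τ)) t
      ((h.contDiffAt_momentum hz).differentiableAt (by simp)).hasFDerivAt h1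
  have h3 : (fun τ => fderiv ℝ (L (u τ)) (deriv u τ)) =ᶠ[𝓝 t]
      fun τ => momentum L (u τ, deriv u τ) := by
    filter_upwards [h1.continuousAt.preimage_mem_nhds (h.isOpen_prod.mem_nhds hz)] with τ hτ
    exact (h.momentum_eq hτ).symm
  have h4 := h2.unique (hEL.congr_of_eventuallyEq h3.symm)
  rw [← h.force_eq hz] at h4
  have h5 : ((deriv u t, deriv (deriv u) t) : E × E) =
      (deriv u t, 0) + ContinuousLinearMap.inr ℝ E E (deriv (deriv u) t) := by simp
  have h6 : fderiv ℝ (momentum L) (u t, deriv u t)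
      (ContinuousLinearMap.inr ℝ E E (deriv (deriv u) t)) =
      fiberHessian L (u t, deriv u t) (deriv (deriv u) t) := rfl
  rw [h5, map_add, h6] at h4
  convert h1 using 1
  rw [spray, ← h4, add_sub_cancel_left, h.inverse_fiberHessian hz]

theorem hasDerivAt_momentum (h : IsChartEnergy U L) {ζ : ℝ → E × E} {t : ℝ}
    (hz : ζ t ∈ U ×ˢ ({0}ᶜ : Set E)) (hζ : HasDerivAt ζ (spray L (ζ t)) t) :
    HasDerivAt (fun τ => momentum L (ζ τ)) (force L (ζ t)) t := by
  rw [← h.fderiv_momentum_spray hz]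
  exact ((h.contDiffAt_momentum hz).differentiableAt (by simp)).hasFDerivAt.comp_hasDerivAt t hζ

theorem hasDerivAt_energy (h : IsChartEnergy U L) {ζ : ℝ → E × E} {t : ℝ}
    (hz : ζ t ∈ U ×ˢ ({0}ᶜ : Set E)) (hζ : HasDerivAt ζ (spray L (ζ t)) t) :
    HasDerivAt (fun τ => Function.uncurry L (ζ τ)) 0 t := by
  rw [← h.fderiv_spray hz]
  exact (h.differentiableAt hz).hasFDerivAt.comp_hasDerivAt t hζ

theorem eventuallyEq_of_hasDerivAt_spray (h : IsChartEnergy U L) {ζ₁ ζ₂ : ℝ → E × E} {t : ℝ}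
    (hz : ζ₁ t ∈ U ×ˢ ({0}ᶜ : Set E)) (h₁ : ∀ᶠ τ in 𝓝 t, HasDerivAt ζ₁ (spray L (ζ₁ τ)) τ)
    (h₂ : ∀ᶠ τ in 𝓝 t, HasDerivAt ζ₂ (spray L (ζ₂ τ)) τ) (heq : ζ₁ t = ζ₂ t) :
    ζ₁ =ᶠ[𝓝 t] ζ₂ := by
  obtain ⟨K, s, hs, hK⟩ := (h.contDiffAt_spray hz).exists_lipschitzOnWith
  have hs₂ : s ∈ 𝓝 (ζ₂ t) := heq ▸ hs
  refine ODE_solution_unique_of_eventually (v := fun _ => spray L) (s := fun _ => s) (K := K)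
    (Eventually.of_forall fun _ => hK) ?_ ?_ heq
  · exact h₁.and (h₁.self_of_nhds.continuousAt.preimage_mem_nhds hs)
  · exact h₂.and (h₂.self_of_nhds.continuousAt.preimage_mem_nhds hs₂)

/-- The first variation formula, in the form in which it gives the Gauss lemma: along a
differentiable family of solutions, the momentum applied to the variation field grows linearly,
at a rate given by the variation of the energy. -/
theorem momentum_variation (h : IsChartEnergy U L) {P : Type*} [NormedAddCommGroup P]
    [NormedSpace ℝ P] {z₀ : E × E} {r : ℝ} {K : NNReal}
    (hr : Metric.closedBall z₀ r ⊆ U ×ˢ ({0}ᶜ : Set E))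
    (hK : ∀ z ∈ Metric.closedBall z₀ r, ‖fderiv ℝ (spray L) z‖ ≤ K) {z : P → ℝ → E × E} {p₀ : P}
    {t₁ t₂ : ℝ} (ht : t₁ ≤ t₂)
    (hz : ∀ᶠ p in 𝓝 p₀, ∀ t ∈ Icc t₁ t₂, z p t ∈ Metric.closedBall z₀ r ∧
      HasDerivAt (z p) (spray L (z p t)) t)
    (hd₁ : DifferentiableAt ℝ (fun p => z p t₁) p₀)
    (hd₂ : DifferentiableAt ℝ (fun p => z p t₂) p₀) (q : P) :
    momentum L (z p₀ t₂) (fderiv ℝ (fun p => z p t₂) p₀ q).1 -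
      momentum L (z p₀ t₁) (fderiv ℝ (fun p => z p t₁) p₀ q).1 =
      (t₂ - t₁) * fderiv ℝ (fun p => Function.uncurry L (z p t₁)) p₀ q := by
  have : ProperSpace (E × E) := FiniteDimensional.proper ℝ (E × E)
  have hspray : ∀ z ∈ Metric.closedBall z₀ r, ContDiffAt ℝ 1 (spray L) z := fun z hz =>
    h.contDiffAt_spray (hr hz)
  have hz₀ := hz.self_of_nhds
  obtain ⟨C, hC0, hC⟩ := exists_norm_sub_le_of_ode hspray hK hz hd₁
  -- Finite-difference form of the claim. Since the momentum changes at the rate of the force, and L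
  -- is constant along each solution, the time derivative of Q p is minus the first-order Taylor
  -- remainder of L between z p₀ t and z p t, which is o(‖p - p₀‖) uniformly in t.
  set Q : P → ℝ → ℝ := fun p t => momentum L (z p₀ t) (z p t - z p₀ t).1 -
    (t - t₁) * (Function.uncurry L (z p t₁) - Function.uncurry L (z p₀ t₁)) with hQ
  have hsmall : (fun p => Q p t₂ - Q p t₁) =o[𝓝 p₀] fun p => p - p₀ := by
    rw [Asymptotics.isLittleO_iff]
    intro e he
    have hT : 0 < t₂ - t₁ + 1 := by linarith
    obtain ⟨ρ, hρ, hunif⟩ := exists_norm_image_sub_sub_fderiv_le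
      (f := Function.uncurry L) (z₀ := z₀) (r := r)
      (fun z hz => (h.contDiffAt (hr hz)).of_le (by norm_cast))
      (η := e / (C * (t₂ - t₁ + 1))) (by positivity)
    have hsm : ∀ᶠ p in 𝓝 p₀, C * ‖p - p₀‖ < ρ := by
      have : Tendsto (fun p => C * ‖p - p₀‖) (𝓝 p₀) (𝓝 (C * ‖p₀ - p₀‖)) :=
        (Continuous.tendsto (by fun_prop) p₀)
      rw [sub_self, norm_zero, mul_zero] at this
      exact this.eventually (gt_mem_nhds hρ)
    filter_upwards [hz, hC, hsm] with p hp hpC hps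
    have hE : ∀ p, (∀ t ∈ Icc t₁ t₂, z p t ∈ Metric.closedBall z₀ r ∧
        HasDerivAt (z p) (spray L (z p t)) t) → ∀ t ∈ Icc t₁ t₂,
        Function.uncurry L (z p t) = Function.uncurry L (z p t₁) := by
      intro p hp
      refine constant_of_has_deriv_right_zero
        (HasDerivAt.continuousOn fun t ht => h.hasDerivAt_energy (hr (hp t ht).1) (hp t ht).2)
        fun t ht => ?_
      have ht := Ico_subset_Icc_self ht
      exact (h.hasDerivAt_energy (hr (hp t ht).1) (hp t ht).2).hasDerivWithinAt
    have hQd : ∀ t ∈ Icc t₁ t₂, HasDerivWithinAt (Q p)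
        (-(Function.uncurry L (z p t) - Function.uncurry L (z p₀ t) -
          fderiv ℝ (Function.uncurry L) (z p₀ t) (z p t - z p₀ t))) (Icc t₁ t₂) t := by
      intro t ht
      have h1 := (h.hasDerivAt_momentum (hr (hz₀ t ht).1) (hz₀ t ht).2).clm_apply
        (ContinuousLinearMap.hasFDerivAt (ContinuousLinearMap.fst ℝ E E)
          |>.comp_hasDerivAt t ((hp t ht).2.sub (hz₀ t ht).2))
      have h2 := h1.sub (((hasDerivAt_id t).sub_const t₁).mul_const
        (Function.uncurry L (z p t₁) - Function.uncurry L (z p₀ t₁)))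
      refine (h2.congr_deriv ?_).hasDerivWithinAt
      rw [hE p hp t ht, hE p₀ hz₀ t ht]
      have h3 : fderiv ℝ (Function.uncurry L) (z p₀ t) (z p t - z p₀ t) =
          force L (z p₀ t) (z p t - z p₀ t).1 + momentum L (z p₀ t) (z p t - z p₀ t).2 := by
        simp only [force, momentum, ContinuousLinearMap.comp_apply, ← map_add]
        congr 1
        ext <;> simp
      rw [h3]
      simp [spray]
    have key := (convex_Icc t₁ t₂).norm_image_sub_le_of_norm_hasDerivWithin_le
      (C := e / (t₂ - t₁ + 1) * ‖p - p₀‖) hQd (fun t ht => ?_)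
      (left_mem_Icc.2 ht) (right_mem_Icc.2 ht)
    · refine key.trans ?_
      rw [Real.norm_of_nonneg (by linarith : (0 : ℝ) ≤ t₂ - t₁)]
      calc e / (t₂ - t₁ + 1) * ‖p - p₀‖ * (t₂ - t₁)
          ≤ e / (t₂ - t₁ + 1) * ‖p - p₀‖ * (t₂ - t₁ + 1) := by gcongr; linarith
        _ = e * ‖p - p₀‖ := by field_simp
    · rw [norm_neg]
      refine (hunif _ (hz₀ t ht).1 _ (hp t ht).1 ((hpC t ht).trans_lt hps)).trans ?_
      calc e / (C * (t₂ - t₁ + 1)) * ‖z p t - z p₀ t‖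
          ≤ e / (C * (t₂ - t₁ + 1)) * (C * ‖p - p₀‖) := by gcongr; exact hpC t ht
        _ = e / (t₂ - t₁ + 1) * ‖p - p₀‖ := by field_simp
  have hzero : HasFDerivAt (fun p => Q p t₂ - Q p t₁) (0 : P →L[ℝ] ℝ) p₀ := by
    rw [hasFDerivAt_iff_isLittleO]
    have hQ0 : ∀ t, Q p₀ t = 0 := fun t => by simp [hQ]
    simpa [hQ0] using hsmall
  have hL : DifferentiableAt ℝ (fun p => Function.uncurry L (z p t₁)) p₀ :=
    DifferentiableAt.comp p₀ (h.differentiableAt (hr (hz₀ t₁ (left_mem_Icc.2 ht)).1)) hd₁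
  have hQt : ∀ t, DifferentiableAt ℝ (fun p => z p t) p₀ → HasFDerivAt (fun p => Q p t)
      ((momentum L (z p₀ t)).comp ((ContinuousLinearMap.fst ℝ E E).comp
        (fderiv ℝ (fun p => z p t) p₀)) -
        (t - t₁) • fderiv ℝ (fun p => Function.uncurry L (z p t₁)) p₀) p₀ := by
    intro t hd
    have h1 := (momentum L (z p₀ t)).hasFDerivAt.comp p₀
      ((ContinuousLinearMap.fst ℝ E E).hasFDerivAt.comp p₀ (hd.hasFDerivAt.sub_const (z p₀ t)))
    have h2 := (hL.hasFDerivAt.sub_const (Function.uncurry L (z p₀ t₁))).const_mul (t - t₁)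
    exact h1.sub h2
  have := congrArg (fun T => T q) (hzero.unique ((hQt t₂ hd₂).sub (hQt t₁ hd₁)))
  simp at this
  linarith

end IsChartEnergy

end Homogeneous

/-! ### The tangent bundle in charts -/

section TangentCharts

open Filter Bundle
open scoped Topology

variable {E : Type*} [NormedAddCommGroup E] [NormedSpace ℝ E]
  {M : Type*} [TopologicalSpace M] [ChartedSpace E M] [IsManifold 𝓘(ℝ, E) ∞ M]

/-- A fibre bundle with Hausdorff base and fibre has a Hausdorff total space. -/
theorem t2Space_totalSpace {B F : Type*} {V : B → Type*} [TopologicalSpace B] [T2Space B]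
    [TopologicalSpace F] [T2Space F] [TopologicalSpace (TotalSpace F V)]
    [∀ b, TopologicalSpace (V b)] [FiberBundle F V] : T2Space (TotalSpace F V) := by
  refine ⟨fun p q hpq => ?_⟩
  by_cases h : p.proj = q.proj
  · set e := trivializationAt F V p.proj
    have hp : p ∈ e.source := e.mem_source.2 (FiberBundle.mem_baseSet_trivializationAt' p.proj)
    have hq : q ∈ e.source := e.mem_source.2 (h ▸ FiberBundle.mem_baseSet_trivializationAt' p.proj)
    have hne : e p ≠ e q := fun h => hpq (e.injOn hp hq h)
    obtain ⟨s, t, hs, ht, hps, hqt, hst⟩ := t2_separation hne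
    refine ⟨e.source ∩ e ⁻¹' s, e.source ∩ e ⁻¹' t,
      e.continuousOn.isOpen_inter_preimage e.open_source hs,
      e.continuousOn.isOpen_inter_preimage e.open_source ht, ⟨hp, hps⟩, ⟨hq, hqt⟩, ?_⟩
    exact (hst.preimage e).mono inter_subset_right inter_subset_right
  · obtain ⟨s, t, hs, ht, hps, hqt, hst⟩ := t2_separation h
    have hc := FiberBundle.continuous_proj F V
    exact ⟨_, _, hs.preimage hc, ht.preimage hc, hps, hqt, hst.preimage _⟩

/-- The chart of the tangent bundle induced by the preferred chart of `M` at `a`. -/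
noncomputable abbrev tangentChart (a : M) : PartialEquiv (TangentBundle 𝓘(ℝ, E) M) (E × E) :=
  extChartAt 𝓘(ℝ, E).tangent (⟨a, 0⟩ : TangentBundle 𝓘(ℝ, E) M)

theorem mem_tangentChart_source {a : M} {p : TangentBundle 𝓘(ℝ, E) M} :
    p ∈ (tangentChart a).source ↔ p.1 ∈ (extChartAt 𝓘(ℝ, E) a).source := by
  rw [tangentChart, extChartAt_source, extChartAt_source, TangentBundle.mem_chart_source_iff]

theorem mem_tangentChart_target {a : M} {z : E × E} :
    z ∈ (tangentChart a).target ↔ z.1 ∈ (extChartAt 𝓘(ℝ, E) a).target := by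
  have := FiberBundle.extChartAt_target (IB := 𝓘(ℝ, E)) (F := E)
    (⟨a, 0⟩ : TangentBundle 𝓘(ℝ, E) M)
  rw [tangentChart]
  erw [this]
  simp only [mem_prod, mem_inter_iff, mem_univ, and_true, mem_preimage]
  refine and_iff_left_of_imp fun h => ?_
  have := (extChartAt 𝓘(ℝ, E) a).map_target h
  rwa [extChartAt_source] at this

/-- With its counterpart for the inverse, this formula carries every transfer between F on the
fibres and `localEnergy` in coordinates. -/
theorem tangentChart_apply {a : M} {p : TangentBundle 𝓘(ℝ, E) M}
    (hp : p.1 ∈ (extChartAt 𝓘(ℝ, E) a).source) :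
    tangentChart a p =
      (extChartAt 𝓘(ℝ, E) a p.1, mfderiv 𝓘(ℝ, E) 𝓘(ℝ, E) (extChartAt 𝓘(ℝ, E) a) p.1 p.2) := by
  rw [extChartAt_source] at hp
  have h1 : tangentChart a p = (extChartAt 𝓘(ℝ, E) a p.1,
      (trivializationAt E (TangentSpace 𝓘(ℝ, E)) a p).2) := rfl
  have h2 := congrArg (fun T => T p.2) (TangentBundle.continuousLinearMapAt_trivializationAt
    (I := 𝓘(ℝ, E)) hp)
  rw [h1]
  congr 1
  refine Eq.trans ?_ h2
  rw [Trivialization.continuousLinearMapAt_apply, Trivialization.linearMapAt_apply,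
    if_pos (show p.1 ∈ (trivializationAt E (TangentSpace 𝓘(ℝ, E)) a).baseSet from hp)]

theorem tangentChart_symm_apply {a : M} {u : E} (hu : u ∈ (extChartAt 𝓘(ℝ, E) a).target) (v : E) :
    (tangentChart a).symm (u, v) = ⟨(extChartAt 𝓘(ℝ, E) a).symm u,
      mfderiv 𝓘(ℝ, E) 𝓘(ℝ, E) (extChartAt 𝓘(ℝ, E) a).symm u v⟩ := by
  have hz : (u, v) ∈ (tangentChart a).target := mem_tangentChart_target.2 hu
  have hs := (extChartAt 𝓘(ℝ, E) a).map_target hu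
  have hmap : (⟨(extChartAt 𝓘(ℝ, E) a).symm u,
      mfderiv 𝓘(ℝ, E) 𝓘(ℝ, E) (extChartAt 𝓘(ℝ, E) a).symm u v⟩ : TangentBundle 𝓘(ℝ, E) M) ∈
      (tangentChart a).source := mem_tangentChart_source.2 hs
  rw [← (tangentChart a).left_inv hmap, tangentChart_apply hs,
    (extChartAt 𝓘(ℝ, E) a).right_inv hu]
  congr 2
  have h := mfderiv_extChartAt_comp_mfderivWithin_extChartAt_symm (I := 𝓘(ℝ, E)) hu
  simp only [modelWithCornersSelf_coe, range_id, mfderivWithin_univ] at h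
  exact (congrArg (fun T => T v) h).symm

end TangentCharts

/-! ### Finsler metrics and their energy in charts -/

namespace FinslerMetric

open Filter Bundle
open scoped Topology

variable {E : Type*} [NormedAddCommGroup E] [NormedSpace ℝ E]
  {M : Type*} [TopologicalSpace M] [ChartedSpace E M] [IsManifold 𝓘(ℝ, E) ∞ M]

theorem energy_homogeneous (F : FinslerMetric E M) (y : M) (r : ℝ) (hr : 0 < r) (v : E) :
    F ⟨y, r • v⟩ ^ 2 / 2 = r ^ 2 * (F ⟨y, v⟩ ^ 2 / 2) := by
  have := F.homogeneous y v r hr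
  have h2 : F ⟨y, r • v⟩ = r * F ⟨y, v⟩ := this
  rw [h2]
  ring

/-- Positive definiteness already contains this: without differentiability the Hessian would take
the default value 0. -/
theorem differentiableAt_fderiv_energy (F : FinslerMetric E M) (y : M) {p : E} (hp : p ≠ 0) :
    DifferentiableAt ℝ (fderiv ℝ (fun v : E => F ⟨y, v⟩ ^ 2 / 2)) p := by
  by_contra h
  have := F.posDef y p p hp hp
  rw [fderiv_zero_of_not_differentiableAt h] at this
  simp at this

/-- The metric tensor at `p`, applied to `p` itself, is the derivative of the energy. -/
theorem metricTensor_self (F : FinslerMetric E M) (y : M) (p : TangentSpace 𝓘(ℝ, E) y)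
    (hp : p ≠ 0) : F.metricTensor y p p = fderiv ℝ (fun v : E => F ⟨y, v⟩ ^ 2 / 2) p :=
  fderiv_fderiv_self_of_homogeneous (fun r hr v => F.energy_homogeneous y r hr v)
    (F.differentiableAt_fderiv_energy y hp)

theorem apply_zero (F : FinslerMetric E M) (y : M) : F ⟨y, (0 : TangentSpace 𝓘(ℝ, E) y)⟩ = 0 := by
  have h := F.homogeneous y (0 : TangentSpace 𝓘(ℝ, E) y) 2 two_pos
  rw [smul_zero] at h
  linarith

theorem nonneg (F : FinslerMetric E M) (p : TangentBundle 𝓘(ℝ, E) M) : 0 ≤ F p := by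
  by_cases h : p.2 = 0
  · have : p = ⟨p.1, 0⟩ := by rw [← h]
    rw [this]
    exact (F.apply_zero p.1).ge
  · exact (F.pos p.1 p.2 h).le

theorem apply_eq_zero_iff (F : FinslerMetric E M) (p : TangentBundle 𝓘(ℝ, E) M) :
    F p = 0 ↔ p.2 = 0 := by
  refine ⟨fun h => ?_, fun h => ?_⟩
  · by_contra h0
    exact (F.pos p.1 p.2 h0).ne' h
  · have : p = ⟨p.1, 0⟩ := by rw [← h]
    rw [this]
    exact F.apply_zero p.1

theorem localEnergy_eq (F : FinslerMetric E M) {a : M} {u : E}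
    (hu : u ∈ (extChartAt 𝓘(ℝ, E) a).target) (v : E) :
    F.localEnergy a u v = F ⟨(extChartAt 𝓘(ℝ, E) a).symm u,
      mfderiv 𝓘(ℝ, E) 𝓘(ℝ, E) (extChartAt 𝓘(ℝ, E) a).symm u v⟩ ^ 2 / 2 := by
  rw [localEnergy, ← tangentChart_symm_apply hu]

theorem localEnergy_tangentChart (F : FinslerMetric E M) {a : M} {p : TangentBundle 𝓘(ℝ, E) M}
    (hp : p.1 ∈ (extChartAt 𝓘(ℝ, E) a).source) :
    Function.uncurry (F.localEnergy a) (tangentChart a p) = F p ^ 2 / 2 := by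
  simp only [Function.uncurry, localEnergy, Prod.mk.eta]
  rw [(tangentChart a).left_inv (mem_tangentChart_source.2 hp)]

/-- The derivative of the inverse of the chart at `a`, as an isomorphism of the model space. -/
theorem exists_mfderiv_extChartAt_symm_equiv {a : M} {u : E}
    (hu : u ∈ (extChartAt 𝓘(ℝ, E) a).target) :
    ∃ A : E ≃L[ℝ] E, ∀ v : E,
      A v = mfderiv 𝓘(ℝ, E) 𝓘(ℝ, E) (extChartAt 𝓘(ℝ, E) a).symm u v := by
  have h := isInvertible_mfderivWithin_extChartAt_symm (I := 𝓘(ℝ, E)) hu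
  simp only [modelWithCornersSelf_coe, range_id, mfderivWithin_univ] at h
  obtain ⟨A, hA⟩ := h
  exact ⟨A, fun v => congrArg (fun T => T v) hA⟩

/-- The derivative of the chart at `a`, as an isomorphism of the model space. -/
theorem exists_mfderiv_extChartAt_equiv {a y : M} (hy : y ∈ (extChartAt 𝓘(ℝ, E) a).source) :
    ∃ A : E ≃L[ℝ] E, ∀ v : E,
      A v = mfderiv 𝓘(ℝ, E) 𝓘(ℝ, E) (extChartAt 𝓘(ℝ, E) a) y v := by
  obtain ⟨A, hA⟩ := isInvertible_mfderiv_extChartAt (I := 𝓘(ℝ, E)) hy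
  exact ⟨A, fun v => congrArg (fun T => T v) hA⟩

theorem snd_tangentChart_symm_ne_zero {a : M} {z : E × E}
    (hz : z ∈ (extChartAt 𝓘(ℝ, E) a).target ×ˢ ({0}ᶜ : Set E)) :
    ((tangentChart a).symm z).2 ≠ 0 := by
  obtain ⟨u, v⟩ := z
  rw [tangentChart_symm_apply hz.1]
  obtain ⟨A, hA⟩ := exists_mfderiv_extChartAt_symm_equiv hz.1
  have h1 : mfderiv 𝓘(ℝ, E) 𝓘(ℝ, E) (extChartAt 𝓘(ℝ, E) a).symm u v ≠ (0 : E) := by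
    rw [← hA v]
    exact (map_ne_zero_iff A A.injective).2 hz.2
  exact h1

theorem snd_tangentChart_eq_zero_iff {a : M} {p : TangentBundle 𝓘(ℝ, E) M}
    (hp : p.1 ∈ (extChartAt 𝓘(ℝ, E) a).source) : (tangentChart a p).2 = 0 ↔ p.2 = 0 := by
  obtain ⟨A, hA⟩ := exists_mfderiv_extChartAt_equiv hp
  have h1 : (tangentChart a p).2 = A p.2 := by
    rw [tangentChart_apply hp]
    exact (hA p.2).symm
  rw [h1]
  exact map_eq_zero_iff A A.injective

theorem tangentChart_mem_prod {a : M} {p : TangentBundle 𝓘(ℝ, E) M}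
    (hp : p.1 ∈ (extChartAt 𝓘(ℝ, E) a).source) (hv : p.2 ≠ 0) :
    tangentChart a p ∈ (extChartAt 𝓘(ℝ, E) a).target ×ˢ ({0}ᶜ : Set E) :=
  ⟨(extChartAt 𝓘(ℝ, E) a).map_source hp, (snd_tangentChart_eq_zero_iff hp).not.2 hv⟩

theorem fderiv_fderiv_comp_equiv {G : E → ℝ} (A : E ≃L[ℝ] E) {v : E}
    (hd : DifferentiableAt ℝ (fderiv ℝ G) (A v)) (w : E) :
    fderiv ℝ (fderiv ℝ (fun v => G (A v))) v w w =
      fderiv ℝ (fderiv ℝ G) (A v) (A w) (A w) := by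
  have h1 : fderiv ℝ (fun v => G (A v)) =
      fun v => (fderiv ℝ G (A v)).comp (A : E →L[ℝ] E) :=
    funext fun v => A.comp_right_fderiv
  rw [h1]
  have h2 : HasFDerivAt (fun v => fderiv ℝ G (A v))
      ((fderiv ℝ (fderiv ℝ G) (A v)).comp (A : E →L[ℝ] E)) v :=
    hd.hasFDerivAt.comp v A.hasFDerivAt
  rw [(h2.clm_comp (hasFDerivAt_const (A : E →L[ℝ] E) v)).fderiv]
  simp

/-- On each fibre the inverse tangent chart is a linear isomorphism onto T_yM, so homogeneity,
positivity and convexity are pulled back from F, and nonzero vectors go to nonzero vectors, where F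
is smooth. -/
theorem isChartEnergy_localEnergy (F : FinslerMetric E M) (a : M) :
    IsChartEnergy (extChartAt 𝓘(ℝ, E) a).target (F.localEnergy a) where
  isOpen := isOpen_extChartAt_target a
  contDiffOn := by
    rw [← contMDiffOn_iff_contDiffOn]
    have h1 : ContMDiffOn 𝓘(ℝ, E × E) 𝓘(ℝ, E).tangent ∞ (tangentChart a).symm
        (tangentChart a).target :=
      contMDiffOn_extChartAt_symm (I := 𝓘(ℝ, E).tangent) (⟨a, 0⟩ : TangentBundle 𝓘(ℝ, E) M)
    have hsub : (extChartAt 𝓘(ℝ, E) a).target ×ˢ ({0}ᶜ : Set E) ⊆ (tangentChart a).target :=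
      fun z hz => mem_tangentChart_target.2 hz.1
    have h2 := F.contMDiffOn_toFun.comp (h1.mono hsub)
      (fun z hz => snd_tangentChart_symm_ne_zero hz)
    have h3 : ContDiff ℝ ∞ fun r : ℝ => r ^ 2 / 2 := by fun_prop
    exact h3.contMDiff.comp_contMDiffOn h2
  homogeneous u hu r hr v := by
    obtain ⟨A, hA⟩ := exists_mfderiv_extChartAt_symm_equiv hu
    rw [F.localEnergy_eq hu, F.localEnergy_eq hu, ← hA, ← hA, map_smul]
    exact F.energy_homogeneous _ r hr _
  posDef u hu v w hv hw := by
    obtain ⟨A, hA⟩ := exists_mfderiv_extChartAt_symm_equiv hu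
    have h1 : F.localEnergy a u = fun v =>
        (fun v : E => F ⟨(extChartAt 𝓘(ℝ, E) a).symm u, v⟩ ^ 2 / 2) (A v) := by
      ext v
      rw [F.localEnergy_eq hu, ← hA]
    have hv' : A v ≠ 0 := (map_ne_zero_iff A A.injective).2 hv
    have hw' : A w ≠ 0 := (map_ne_zero_iff A A.injective).2 hw
    rw [h1, fderiv_fderiv_comp_equiv A (F.differentiableAt_fderiv_energy _ hv')]
    exact F.posDef _ _ _ hv' hw'
  pos u hu v hv := by
    have h0 := F.pos _ _ (snd_tangentChart_symm_ne_zero (a := a) (z := (u, v)) ⟨hu, hv⟩)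
    rw [localEnergy]
    have h1 : 0 < F ((tangentChart a).symm (u, v)) := h0
    positivity

/-- The derivative of the energy on the fibre, in terms of the momentum in a chart. -/
theorem fderiv_energy_eq_momentum (F : FinslerMetric E M) {a y : M}
    (hy : y ∈ (extChartAt 𝓘(ℝ, E) a).source) {p : E} (hp : p ≠ 0) (w : E) :
    fderiv ℝ (fun v : E => F ⟨y, v⟩ ^ 2 / 2) p w =
      momentum (F.localEnergy a) (tangentChart a (⟨y, p⟩ : TangentBundle 𝓘(ℝ, E) M))
        (mfderiv 𝓘(ℝ, E) 𝓘(ℝ, E) (extChartAt 𝓘(ℝ, E) a) y w) := by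
  obtain ⟨A, hA⟩ := exists_mfderiv_extChartAt_equiv hy
  have hAp : A p ≠ 0 := (map_ne_zero_iff A A.injective).2 hp
  have h1 : (fun v : E => F ⟨y, v⟩ ^ 2 / 2) =
      fun v : E => F.localEnergy a (extChartAt 𝓘(ℝ, E) a y) (A v) := by
    ext v
    rw [hA, ← F.localEnergy_tangentChart (a := a) (p := ⟨y, v⟩) hy, tangentChart_apply hy]
    rfl
  have h2 : tangentChart a (⟨y, p⟩ : TangentBundle 𝓘(ℝ, E) M) =
      (extChartAt 𝓘(ℝ, E) a y, A p) := by
    rw [tangentChart_apply hy, hA]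
    rfl
  rw [h1, h2, ← hA w, (F.isChartEnergy_localEnergy a).momentum_eq
    (z := (extChartAt 𝓘(ℝ, E) a y, A p)) ⟨(extChartAt 𝓘(ℝ, E) a).map_source hy, hAp⟩]
  exact congrArg (fun T => T w)
    (A.comp_right_fderiv (f := F.localEnergy a (extChartAt 𝓘(ℝ, E) a y)))

end FinslerMetric

/-! ### Velocities of curves in charts -/

section Velocity

open Filter Bundle
open scoped Topology

variable {E : Type*} [NormedAddCommGroup E] [NormedSpace ℝ E]
  {M : Type*} [TopologicalSpace M] [ChartedSpace E M] [IsManifold 𝓘(ℝ, E) ∞ M]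

theorem tangentChart_velocityLift {c : ℝ → M} {t : ℝ} (hc : MDifferentiableAt 𝓘(ℝ, ℝ) 𝓘(ℝ, E) c t)
    {a : M} (ha : c t ∈ (extChartAt 𝓘(ℝ, E) a).source) :
    tangentChart a (FinslerMetric.velocityLift (E := E) c t) =
      (extChartAt 𝓘(ℝ, E) a (c t), deriv (fun τ => extChartAt 𝓘(ℝ, E) a (c τ)) t) := by
  rw [tangentChart_apply (p := FinslerMetric.velocityLift c t) ha]
  have ha' := ha
  rw [extChartAt_source] at ha'
  have h1 := mfderiv_comp t (mdifferentiableAt_extChartAt (I := 𝓘(ℝ, E)) ha') hc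
  rw [mfderiv_eq_fderiv] at h1
  have h2 := congrArg (fun T => T (1 : ℝ)) h1
  congr 1
  exact h2.symm

theorem contDiffAt_extChartAt_comp {c : ℝ → M} {t : ℝ} (hc : ContMDiffAt 𝓘(ℝ, ℝ) 𝓘(ℝ, E) ∞ c t)
    {a : M} (ha : c t ∈ (extChartAt 𝓘(ℝ, E) a).source) :
    ContDiffAt ℝ ∞ (fun τ => extChartAt 𝓘(ℝ, E) a (c τ)) t := by
  rw [extChartAt_source] at ha
  rw [← contMDiffAt_iff_contDiffAt]
  exact (contMDiffAt_extChartAt' ha).comp t hc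

theorem eventually_tangentChart_velocityLift {c : ℝ → M} {t : ℝ}
    (hc : ContMDiffAt 𝓘(ℝ, ℝ) 𝓘(ℝ, E) ∞ c t) {a : M} (ha : c t ∈ (extChartAt 𝓘(ℝ, E) a).source) :
    ∀ᶠ τ in 𝓝 t, c τ ∈ (extChartAt 𝓘(ℝ, E) a).source ∧
      tangentChart a (FinslerMetric.velocityLift (E := E) c τ) =
      (extChartAt 𝓘(ℝ, E) a (c τ), deriv (fun τ => extChartAt 𝓘(ℝ, E) a (c τ)) τ) := by
  have : IsManifold 𝓘(ℝ, E) 1 M := .of_le (n := ∞) (by norm_cast)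
  have h1 := hc.of_le (show (1 : WithTop ℕ∞) ≤ ∞ by norm_cast)
  filter_upwards [hc.continuousAt.preimage_mem_nhds ((isOpen_extChartAt_source a).mem_nhds ha),
    (contMDiffAt_iff_contMDiffAt_nhds (by simp)).1 h1] with τ hτ hcτ
  exact ⟨hτ, tangentChart_velocityLift (hcτ.mdifferentiableAt one_ne_zero) hτ⟩

theorem continuousAt_velocityLift {c : ℝ → M} {t : ℝ}
    (hc : ContMDiffAt 𝓘(ℝ, ℝ) 𝓘(ℝ, E) ∞ c t) :
    ContinuousAt (FinslerMetric.velocityLift (E := E) c) t := by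
  have ha := mem_extChartAt_source (I := 𝓘(ℝ, E)) (c t)
  have h0 := eventually_tangentChart_velocityLift hc ha
  have hu := contDiffAt_extChartAt_comp hc ha
  have hz : ContinuousAt (fun τ => (extChartAt 𝓘(ℝ, E) (c t) (c τ),
      deriv (fun τ => extChartAt 𝓘(ℝ, E) (c t) (c τ)) τ)) t :=
    hu.continuousAt.prodMk (hu.derivWithin (m := 0) (by simp)).continuousAt
  have h1 : FinslerMetric.velocityLift c =ᶠ[𝓝 t] fun τ => (tangentChart (c t)).symm
      (extChartAt 𝓘(ℝ, E) (c t) (c τ), deriv (fun τ => extChartAt 𝓘(ℝ, E) (c t) (c τ)) τ) := by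
    filter_upwards [h0] with τ hτ
    rw [← hτ.2, (tangentChart (c t)).left_inv (mem_tangentChart_source.2 hτ.1)]
  refine ContinuousAt.congr ?_ h1.symm
  refine ContinuousAt.comp (f := fun τ => (extChartAt 𝓘(ℝ, E) (c t) (c τ),
    deriv (fun τ => extChartAt 𝓘(ℝ, E) (c t) (c τ)) τ)) ?_ hz
  exact continuousAt_extChartAt_symm'' (I := 𝓘(ℝ, E).tangent)
    (mem_tangentChart_target.2 ((extChartAt 𝓘(ℝ, E) (c t)).map_source ha))

end Velocity

/-! ### Geodesics as integral curves of the spray -/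

namespace FinslerMetric

open Filter Bundle
open scoped Topology

variable {E : Type*} [NormedAddCommGroup E] [NormedSpace ℝ E] [FiniteDimensional ℝ E]
  {M : Type*} [TopologicalSpace M] [ChartedSpace E M] [IsManifold 𝓘(ℝ, E) ∞ M]

/-- In charts, the velocity of a geodesic is an integral curve of the spray. -/
theorem IsGeodesicOn.hasDerivAt_tangentChart {F : FinslerMetric E M} {c : ℝ → M} {s : Set ℝ}
    (hc : F.IsGeodesicOn c s) (hs : IsOpen s) {t : ℝ} (ht : t ∈ s)
    (hv : (velocityLift (E := E) c t).2 ≠ 0) {a : M}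
    (ha : c t ∈ (extChartAt 𝓘(ℝ, E) a).source) :
    HasDerivAt (fun τ => tangentChart a (velocityLift (E := E) c τ))
      (spray (F.localEnergy a) (tangentChart a (velocityLift (E := E) c t))) t := by
  have hct := hc.smooth.contMDiffAt (hs.mem_nhds ht)
  have h0 := eventually_tangentChart_velocityLift hct ha
  have hu := contDiffAt_extChartAt_comp hct ha
  rw [h0.self_of_nhds.2]
  refine HasDerivAt.congr_of_eventuallyEq ?_ (h0.mono fun τ hτ => hτ.2)
  refine (F.isChartEnergy_localEnergy a).hasDerivAt_spray ((extChartAt 𝓘(ℝ, E) a).map_source ha)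
    ?_ (hu.differentiableAt (by simp))
    ((hu.derivWithin (m := 1) (by norm_cast)).differentiableAt one_ne_zero)
    (hc.eulerLagrange a t ht ha)
  have h1 := (snd_tangentChart_eq_zero_iff (p := velocityLift c t) ha).not.2 hv
  rwa [h0.self_of_nhds.2] at h1

end FinslerMetric

/-! ### Connectedness and continuation arguments -/

section Induction

open Filter
open scoped Topology

/-- The truth value of p is locally constant on S, hence constant. -/
theorem IsPreconnected.forall_of_eventually {α : Type*} [TopologicalSpace α] {S : Set α}
    (hS : IsPreconnected S) {p : α → Prop} (h : ∀ t ∈ S, p t → ∀ᶠ s in 𝓝 t, p s)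
    (h' : ∀ t ∈ S, ¬ p t → ∀ᶠ s in 𝓝 t, ¬ p s) {t₀ t : α} (ht₀ : t₀ ∈ S) (ht : t ∈ S)
    (hp : p t₀) : p t := by
  refine (hS.induction₂ (fun s t => p s ↔ p t) (fun s hs => nhdsWithin_le_nhds ?_)
    (fun _ _ _ _ _ _ h₁ h₂ => h₁.trans h₂) (fun _ _ _ _ h => h.symm) ht₀ ht).1 hp
  by_cases hps : p s
  · filter_upwards [h s hs hps] with τ hτ using by simp [hps, hτ]
  · filter_upwards [h' s hs hps] with τ hτ using by simp [hps, hτ]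

theorem eventually_eq_of_hasDerivAt_zero {G : Type*} [NormedAddCommGroup G] [NormedSpace ℝ G]
    {f : ℝ → G} {t : ℝ} (h : ∀ᶠ τ in 𝓝 t, HasDerivAt f 0 τ) : ∀ᶠ τ in 𝓝 t, f τ = f t := by
  obtain ⟨ε, hε, hball⟩ := Metric.eventually_nhds_iff_ball.1 h
  filter_upwards [Metric.ball_mem_nhds t hε] with τ hτ
  exact Metric.isOpen_ball.is_const_of_deriv_eq_zero (convex_ball t ε).isPreconnected
    (fun σ hσ => (hball σ hσ).differentiableAt.differentiableWithinAt)
    (fun σ hσ => (hball σ hσ).deriv) hτ (Metric.mem_ball_self hε)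

/-- A property of the points of `[0, 1]` which propagates locally to the right holds at `1` if it
holds at `0`. -/
theorem unitInterval_forward_induction {Q : ℝ → Prop} (h0 : Q 0)
    (h : ∀ t₀ ∈ Icc (0 : ℝ) 1, ∃ η > 0, ∀ t₁ ∈ Icc (0 : ℝ) 1, ∀ t₂ ∈ Icc (0 : ℝ) 1,
      |t₁ - t₀| < η → |t₂ - t₀| < η → t₁ ≤ t₂ → Q t₁ → Q t₂) : Q 1 := by
  set S : Set ℝ := {t | t ∈ Icc (0 : ℝ) 1 ∧ Q t} with hS
  have hS0 : (0 : ℝ) ∈ S := ⟨by simp, h0⟩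
  have hbdd : BddAbove S := ⟨1, fun t ht => ht.1.2⟩
  have hs0 : 0 ≤ sSup S := le_csSup hbdd hS0
  have hs1 : sSup S ≤ 1 := csSup_le ⟨0, hS0⟩ fun t ht => ht.1.2
  obtain ⟨η, hη, hprop⟩ := h (sSup S) ⟨hs0, hs1⟩
  -- The supremum need not lie in S, so the propagation starts at a point of S less than η below it
  -- and jumps beyond it: either to sSup S + η / 2, which is absurd, or to 1.
  obtain ⟨t₁, ht₁, hlt⟩ := exists_lt_of_lt_csSup ⟨0, hS0⟩ (show sSup S - η < sSup S by linarith)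
  have hle := le_csSup hbdd ht₁
  have key : ∀ t₂ ∈ Icc (0 : ℝ) 1, |t₂ - sSup S| < η → sSup S ≤ t₂ → Q t₂ := fun t₂ ht₂ h₁ h₂ =>
    hprop t₁ ht₁.1 t₂ ht₂ (by rw [abs_lt]; constructor <;> linarith) h₁ (hle.trans h₂) ht₁.2
  by_cases h1 : sSup S + η / 2 < 1
  · have hQ := key (sSup S + η / 2) ⟨by linarith, h1.le⟩
      (by rw [abs_lt]; constructor <;> linarith) (by linarith)
    have := le_csSup hbdd (show sSup S + η / 2 ∈ S from ⟨⟨by linarith, h1.le⟩, hQ⟩)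
    linarith
  · exact key 1 (by simp) (by rw [abs_lt]; constructor <;> linarith) hs1

/-- A curve which can only leave a compact subset of a chart through its interior stays in it. -/
theorem PartialEquiv.forall_mem_of_forall_mem {N Z : Type*} [TopologicalSpace N] [T2Space N]
    [TopologicalSpace Z] (e : PartialEquiv N Z) (he : IsOpen e.source)
    (hec : ContinuousOn e e.source) (hes : ContinuousOn e.symm e.target) {K O : Set Z}
    (hK : IsCompact K) (hKt : K ⊆ e.target) (hO : IsOpen O) (hOK : O ⊆ K) {γ : ℝ → N} {t₁ t₂ : ℝ}
    (hγ : ∀ t ∈ Icc t₁ t₂, ContinuousAt γ t) (h₁ : γ t₁ ∈ e.source) (h₁' : e (γ t₁) ∈ K)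
    (hstep : ∀ t ∈ Icc t₁ t₂, (∀ τ ∈ Icc t₁ t, γ τ ∈ e.source ∧ e (γ τ) ∈ K) → e (γ t) ∈ O) :
    ∀ t ∈ Icc t₁ t₂, γ t ∈ e.source ∧ e (γ t) ∈ K := by
  have hiff : ∀ p, p ∈ e.symm '' K ↔ p ∈ e.source ∧ e p ∈ K := by
    refine fun p => ⟨?_, fun h => ⟨e p, h.2, e.left_inv h.1⟩⟩
    rintro ⟨z, hz, rfl⟩
    exact ⟨e.map_target (hKt hz), by rwa [e.right_inv (hKt hz)]⟩
  -- Here the Hausdorff property enters: the compact image of K is closed in N, so a limit of times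
  -- at which the curve lies in it cannot fall outside the chart.
  have hKc : IsClosed (e.symm '' K) := (hK.image_of_continuousOn (hes.mono hKt)).isClosed
  have hγc : ContinuousOn γ (Icc t₁ t₂) := fun t ht => (hγ t ht).continuousWithinAt
  set S : Set ℝ := {t | ∀ τ ∈ Icc t₁ t, γ τ ∈ e.source ∧ e (γ τ) ∈ K} with hS
  have hSc : IsClosed (S ∩ Icc t₁ t₂) := by
    refine isClosed_of_closure_subset fun t ht => ?_
    have ht' : t ∈ Icc t₁ t₂ := closure_minimal inter_subset_right isClosed_Icc ht
    refine ⟨fun τ hτ => ?_, ht'⟩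
    rcases hτ.2.lt_or_eq with hlt | rfl
    · obtain ⟨s, hs, hsS⟩ := mem_closure_iff_nhds.1 ht _ (lt_mem_nhds hlt)
      exact hsS.1 τ ⟨hτ.1, le_of_lt hs⟩
    · have h2 := closure_minimal (t := Icc t₁ t₂ ∩ γ ⁻¹' (e.symm '' K))
        (fun s hs => ⟨hs.2, (hiff _).2 (hs.1 s ⟨hs.2.1, le_rfl⟩)⟩)
        (hγc.preimage_isClosed_of_isClosed isClosed_Icc hKc) ht
      exact (hiff _).1 h2.2
  have hsub := hSc.Icc_subset_of_forall_mem_nhdsWithin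
    (fun τ hτ => by
      have : τ = t₁ := le_antisymm hτ.2 hτ.1
      exact this ▸ ⟨h₁, h₁'⟩)
    (fun t ht => by
      have htt := Ico_subset_Icc_self ht.2
      have hmem := ht.1 t ⟨htt.1, le_rfl⟩
      have hnhds : γ ⁻¹' (e.source ∩ e ⁻¹' O) ∈ 𝓝 t := (hγ t htt).preimage_mem_nhds
        ((hec.isOpen_inter_preimage he hO).mem_nhds ⟨hmem.1, hstep t htt ht.1⟩)
      obtain ⟨ε, hε, hball⟩ := Metric.mem_nhds_iff.1 hnhds
      have hε' : Iio (t + ε) ∈ 𝓝[>] t := nhdsWithin_le_nhds (Iio_mem_nhds (by linarith))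
      filter_upwards [hε'] with s hs τ hτ
      rcases le_or_gt τ t with hle | hgt
      · exact ht.1 τ ⟨hτ.1, hle⟩
      · have : τ ∈ Metric.ball t ε := by
          rw [Metric.mem_ball, Real.dist_eq, abs_lt]
          have := hs.out
          constructor <;> linarith [hτ.2]
        exact ⟨(hball this).1, hOK (hball this).2⟩)
  exact fun t ht => hsub ht t ⟨ht.1, le_rfl⟩

end Induction

/-! ### Speed, uniqueness and rescaling of geodesics -/

theorem FinslerMetric.velocityLift_comp_mul {E : Type*} [NormedAddCommGroup E] [NormedSpace ℝ E]
    {M : Type*} [TopologicalSpace M] [ChartedSpace E M] {c : ℝ → M} (r t : ℝ)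
    (hc : MDifferentiableAt 𝓘(ℝ, ℝ) 𝓘(ℝ, E) c (r * t)) :
    FinslerMetric.velocityLift (E := E) (fun τ => c (r * τ)) t =
      ⟨c (r * t), r • (FinslerMetric.velocityLift (E := E) c (r * t)).2⟩ := by
  have h1 : HasMFDerivAt 𝓘(ℝ, ℝ) 𝓘(ℝ, ℝ) (fun τ : ℝ => r * τ) t
      (ContinuousLinearMap.toSpanSingleton ℝ r) :=
    (((hasDerivAt_id t).const_mul r).congr_deriv (mul_one r)).hasFDerivAt.hasMFDerivAt
  have h2 := (hc.hasMFDerivAt.comp t h1).mfderiv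
  have h3 : mfderiv 𝓘(ℝ, ℝ) 𝓘(ℝ, E) (fun τ => c (r * τ)) t (1 : ℝ) =
      r • mfderiv 𝓘(ℝ, ℝ) 𝓘(ℝ, E) c (r * t) (1 : ℝ) := by
    refine (congrArg (fun T => T (1 : ℝ)) h2).trans ?_
    have h4 : ContinuousLinearMap.toSpanSingleton ℝ r (1 : ℝ) = r • (1 : ℝ) := by simp
    refine Eq.trans ?_ ((mfderiv 𝓘(ℝ, ℝ) 𝓘(ℝ, E) c (r * t)).map_smul r (1 : ℝ))
    exact congrArg (mfderiv 𝓘(ℝ, ℝ) 𝓘(ℝ, E) c (r * t)) h4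
  simp only [FinslerMetric.velocityLift]
  rw [h3]
  rfl

namespace FinslerMetric

open Filter Bundle
open scoped Topology

variable {E : Type*} [NormedAddCommGroup E] [NormedSpace ℝ E]
  {M : Type*} [TopologicalSpace M] [ChartedSpace E M] [IsManifold 𝓘(ℝ, E) ∞ M]
  {F : FinslerMetric E M} {c c₁ c₂ : ℝ → M} {s : Set ℝ}

theorem IsGeodesicOn.mono (hc : F.IsGeodesicOn c s) {s' : Set ℝ} (hs : s' ⊆ s) :
    F.IsGeodesicOn c s' :=
  ⟨hc.smooth.mono hs, fun a t ht ha => hc.eulerLagrange a t (hs ht) ha⟩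

theorem IsGeodesicOn.continuousAt_velocityLift (hc : F.IsGeodesicOn c s) (hs : IsOpen s) {t : ℝ}
    (ht : t ∈ s) : ContinuousAt (velocityLift (E := E) c) t :=
  _root_.continuousAt_velocityLift (hc.smooth.contMDiffAt (hs.mem_nhds ht))

theorem IsGeodesicOn.continuousAt_speed (hc : F.IsGeodesicOn c s) (hs : IsOpen s) {t : ℝ}
    (ht : t ∈ s) : ContinuousAt (fun τ => F (velocityLift c τ)) t :=
  F.continuous_toFun.continuousAt.comp (hc.continuousAt_velocityLift hs ht)

/-- Nonzero speed persists nearby by continuity, so the lift is an integral curve of the spray there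
and keeps its energy. Since F ≥ 0, equal energies mean equal speeds. -/
theorem IsGeodesicOn.eventually_speed_eq [FiniteDimensional ℝ E] (hc : F.IsGeodesicOn c s)
    (hs : IsOpen s) {t : ℝ} (ht : t ∈ s) (hne : F (velocityLift c t) ≠ 0) :
    ∀ᶠ τ in 𝓝 t, F (velocityLift c τ) = F (velocityLift c t) := by
  have hsrc : ∀ᶠ τ in 𝓝 t, c τ ∈ (extChartAt 𝓘(ℝ, E) (c t)).source :=
    (hc.smooth.contMDiffAt (hs.mem_nhds ht)).continuousAt.preimage_mem_nhds
      ((isOpen_extChartAt_source (c t)).mem_nhds (mem_extChartAt_source (c t)))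
  have hev : ∀ᶠ τ in 𝓝 t, HasDerivAt (fun τ => Function.uncurry (F.localEnergy (c t))
      (tangentChart (c t) (velocityLift c τ))) 0 τ ∧
      c τ ∈ (extChartAt 𝓘(ℝ, E) (c t)).source := by
    filter_upwards [hsrc, (hc.continuousAt_speed hs ht).eventually_ne hne, hs.mem_nhds ht]
      with τ hτ hF hτs
    have hv : (velocityLift (E := E) c τ).2 ≠ 0 := fun h => hF ((F.apply_eq_zero_iff _).2 h)
    refine ⟨(F.isChartEnergy_localEnergy (c t)).hasDerivAt_energy ?_
      (hc.hasDerivAt_tangentChart hs hτs hv hτ), hτ⟩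
    exact tangentChart_mem_prod (p := velocityLift c τ) hτ hv
  filter_upwards [eventually_eq_of_hasDerivAt_zero (hev.mono fun τ hτ => hτ.1), hsrc] with τ h1 hτ
  rw [F.localEnergy_tangentChart (p := velocityLift c τ) hτ,
    F.localEnergy_tangentChart (p := velocityLift c t) (mem_extChartAt_source (c t))] at h1
  exact (pow_left_inj₀ (F.nonneg _) (F.nonneg _) two_ne_zero).1 (by linarith)

/-- Geodesics have constant speed. -/
theorem IsGeodesicOn.speed_eq [FiniteDimensional ℝ E] (hc : F.IsGeodesicOn c s) (hs : IsOpen s)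
    (hs' : IsPreconnected s) {t t' : ℝ} (ht : t ∈ s) (ht' : t' ∈ s) :
    F (velocityLift c t) = F (velocityLift c t') := by
  have key : ∀ t ∈ s, F (velocityLift c t) ≠ 0 → ∀ t' ∈ s,
      F (velocityLift c t') = F (velocityLift c t) := by
    intro t ht hne t' ht'
    refine hs'.forall_of_eventually (p := fun τ => F (velocityLift c τ) = F (velocityLift c t))
      (fun τ hτ hp => ?_) (fun τ hτ hp => (hc.continuousAt_speed hs hτ).eventually_ne hp) ht ht' rfl
    filter_upwards [hc.eventually_speed_eq hs hτ (by rwa [hp])] with σ hσ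
    rw [hσ, hp]
  by_cases h : F (velocityLift c t) = 0
  · by_cases h' : F (velocityLift c t') = 0
    · rw [h, h']
    · exact key t' ht' h' t ht
  · exact (key t ht h t' ht').symm

/-- This replaces ODE uniqueness on the zero section, where the spray is not controlled: constancy
of speed makes the velocity vanish at all times, and the curve is locally constant in charts. -/
theorem IsGeodesicOn.eqOn_const [FiniteDimensional ℝ E] [T2Space M] (hc : F.IsGeodesicOn c s)
    (hs : IsOpen s) (hs' : IsPreconnected s) {t₀ t : ℝ} (ht₀ : t₀ ∈ s) (ht : t ∈ s)
    (h0 : (velocityLift (E := E) c t₀).2 = 0) : c t = c t₀ := by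
  have hzero : ∀ τ ∈ s, (velocityLift (E := E) c τ).2 = 0 := fun τ hτ => by
    rw [← F.apply_eq_zero_iff, hc.speed_eq hs hs' hτ ht₀, F.apply_eq_zero_iff, h0]
  have hcont : ∀ τ ∈ s, ContinuousAt c τ := fun τ hτ =>
    (hc.smooth.contMDiffAt (hs.mem_nhds hτ)).continuousAt
  refine hs'.forall_of_eventually (p := fun τ => c τ = c t₀) (fun τ hτ hp => ?_)
    (fun τ hτ hp => (hcont τ hτ).eventually_ne hp) ht₀ ht rfl
  have hcτ := hc.smooth.contMDiffAt (hs.mem_nhds hτ)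
  have hev := eventually_tangentChart_velocityLift hcτ (mem_extChartAt_source (c τ))
  have hzero' : ∀ᶠ σ in 𝓝 τ, HasDerivAt (fun σ => extChartAt 𝓘(ℝ, E) (c τ) (c σ)) 0 σ := by
    filter_upwards [hev, hs.mem_nhds hτ] with σ hσ hσs
    have h1 := ((contDiffAt_extChartAt_comp (hc.smooth.contMDiffAt (hs.mem_nhds hσs))
      hσ.1).differentiableAt (by simp)).hasDerivAt
    have h2 := (snd_tangentChart_eq_zero_iff (p := velocityLift c σ) hσ.1).2 (hzero σ hσs)
    rw [hσ.2] at h2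
    exact h1.congr_deriv h2
  filter_upwards [eventually_eq_of_hasDerivAt_zero hzero', hev] with σ h1 h2
  rw [← hp]
  exact (extChartAt 𝓘(ℝ, E) (c τ)).injOn h2.1 (mem_extChartAt_source (c τ)) h1

/-- A geodesic is determined by its velocity at one time. -/
theorem IsGeodesicOn.eqOn [FiniteDimensional ℝ E] [T2Space M] (hc₁ : F.IsGeodesicOn c₁ s)
    (hc₂ : F.IsGeodesicOn c₂ s) (hs : IsOpen s) (hs' : IsPreconnected s) {t₀ t : ℝ} (ht₀ : t₀ ∈ s)
    (ht : t ∈ s) (h0 : velocityLift (E := E) c₁ t₀ = velocityLift c₂ t₀) : c₁ t = c₂ t := by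
  by_cases hv : (velocityLift (E := E) c₁ t₀).2 = 0
  · have hv₂ : (velocityLift (E := E) c₂ t₀).2 = 0 := by rwa [← h0]
    rw [hc₁.eqOn_const hs hs' ht₀ ht hv, hc₂.eqOn_const hs hs' ht₀ ht hv₂]
    exact congrArg TotalSpace.proj h0
  have : T2Space (TangentBundle 𝓘(ℝ, E) M) := t2Space_totalSpace
  have hne : ∀ τ ∈ s, (velocityLift (E := E) c₁ τ).2 ≠ 0 := fun τ hτ h => by
    rw [← F.apply_eq_zero_iff, hc₁.speed_eq hs hs' hτ ht₀, F.apply_eq_zero_iff] at h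
    exact hv h
  -- The velocities agree on an open set of times by local uniqueness for the spray, and on a closed
  -- one because the tangent bundle is Hausdorff.
  refine congrArg TotalSpace.proj (hs'.forall_of_eventually
    (p := fun τ => velocityLift (E := E) c₁ τ = velocityLift c₂ τ) (fun τ hτ hp => ?_)
    (fun τ hτ hp => ?_) ht₀ ht h0)
  · have hp' : c₁ τ = c₂ τ := congrArg TotalSpace.proj hp
    have ha := mem_extChartAt_source (I := 𝓘(ℝ, E)) (c₁ τ)
    have ha₂ : c₂ τ ∈ (extChartAt 𝓘(ℝ, E) (c₁ τ)).source := hp' ▸ ha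
    have hsrc : ∀ {c : ℝ → M}, F.IsGeodesicOn c s → c τ ∈ (extChartAt 𝓘(ℝ, E) (c₁ τ)).source →
        ∀ᶠ σ in 𝓝 τ, c σ ∈ (extChartAt 𝓘(ℝ, E) (c₁ τ)).source := fun hc h =>
      (hc.smooth.contMDiffAt (hs.mem_nhds hτ)).continuousAt.preimage_mem_nhds
        ((isOpen_extChartAt_source (c₁ τ)).mem_nhds h)
    have hv₂ : (velocityLift (E := E) c₂ τ).2 ≠ 0 := by
      rw [← hp]
      exact hne τ hτ
    have hne₂ : ∀ᶠ σ in 𝓝 τ, (velocityLift (E := E) c₂ σ).2 ≠ 0 := by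
      filter_upwards [(hc₂.continuousAt_speed hs hτ).eventually_ne
        ((F.apply_eq_zero_iff _).not.2 hv₂)] with σ hσ
      exact (F.apply_eq_zero_iff _).not.1 hσ
    have key := (F.isChartEnergy_localEnergy (c₁ τ)).eventuallyEq_of_hasDerivAt_spray
      (ζ₁ := fun σ => tangentChart (c₁ τ) (velocityLift c₁ σ))
      (ζ₂ := fun σ => tangentChart (c₁ τ) (velocityLift c₂ σ)) (t := τ)
      (tangentChart_mem_prod (p := velocityLift c₁ τ) ha (hne τ hτ))
      (by
        filter_upwards [hsrc hc₁ ha, hs.mem_nhds hτ] with σ h1 h2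
        exact hc₁.hasDerivAt_tangentChart hs h2 (hne σ h2) h1)
      (by
        filter_upwards [hsrc hc₂ ha₂, hs.mem_nhds hτ, hne₂] with σ h1 h2 h3
        exact hc₂.hasDerivAt_tangentChart hs h2 h3 h1)
      (by rw [hp])
    filter_upwards [key, hsrc hc₁ ha, hsrc hc₂ ha₂] with σ h1 h2 h3
    exact (tangentChart (c₁ τ)).injOn (mem_tangentChart_source.2 h2)
      (mem_tangentChart_source.2 h3) h1
  · exact ((hc₁.continuousAt_velocityLift hs hτ).prodMk
      (hc₂.continuousAt_velocityLift hs hτ)).preimage_mem_nhds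
        (isClosed_diagonal.isOpen_compl.mem_nhds hp)

/-- Affine reparametrizations of geodesics are geodesics. -/
theorem IsGeodesicOn.comp_mul (hc : F.IsGeodesicOn c s) (hs : IsOpen s) {r : ℝ} (hr : 0 < r) :
    F.IsGeodesicOn (fun τ => c (r * τ)) ((fun τ => r * τ) ⁻¹' s) where
  smooth := hc.smooth.comp (t := s) (ContDiff.contMDiff (by fun_prop)).contMDiffOn fun t ht => ht
  eulerLagrange a t ht ha := by
    simp only
    set L := F.localEnergy a
    set u : ℝ → E := fun τ => extChartAt 𝓘(ℝ, E) a (c τ) with hu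
    have h0 := hc.eulerLagrange a (r * t) ht ha
    have hder : ∀ τ, deriv (fun τ => u (r * τ)) τ = r • deriv u (r * τ) := fun τ =>
      deriv_comp_mul_left r u τ
    have hut : u (r * t) ∈ (extChartAt 𝓘(ℝ, E) a).target := (extChartAt 𝓘(ℝ, E) a).map_source ha
    have hopen := isOpen_extChartAt_target (I := 𝓘(ℝ, E)) a
    have hL := (F.isChartEnergy_localEnergy a).homogeneous
    have hucont : ContinuousAt (fun τ => u (r * τ)) t := by
      have h1 : ContinuousAt u (r * t) := (contDiffAt_extChartAt_comp
        (hc.smooth.contMDiffAt (hs.mem_nhds ht)) ha).continuousAt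
      exact ContinuousAt.comp (f := fun τ => r * τ) h1 (by fun_prop)
    -- The momentum has degree one in the velocity and the chain rule contributes another factor r;
    -- the force has degree two. Both sides are thus multiplied by r².
    have h1 : HasDerivAt (fun τ => r • fderiv ℝ (L (u (r * τ))) (deriv u (r * τ)))
        (r • r • fderiv ℝ (fun w => L w (deriv u (r * t))) (u (r * t))) t := by
      have h2 : HasDerivAt (fun τ : ℝ => r * τ) r t :=
        ((hasDerivAt_id t).const_mul r).congr_deriv (mul_one r)
      exact (HasDerivAt.scomp t (h := fun τ => r * τ) h0 h2).const_smul r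
    have h3 : (fun τ => fderiv ℝ (L (u (r * τ))) (deriv (fun τ => u (r * τ)) τ)) =ᶠ[𝓝 t]
        fun τ => r • fderiv ℝ (L (u (r * τ))) (deriv u (r * τ)) := by
      filter_upwards [hucont.preimage_mem_nhds (hopen.mem_nhds hut)] with τ hτ
      rw [hder]
      exact fderiv_smul_of_homogeneous (hL _ hτ) hr _
    have h4 : (fun w => L w (deriv (fun τ => u (r * τ)) t)) =ᶠ[𝓝 (u (r * t))]
        (r ^ 2) • fun w => L w (deriv u (r * t)) := by
      filter_upwards [hopen.mem_nhds hut] with w hw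
      rw [hder]
      exact hL w hw r hr _
    refine (h1.congr_of_eventuallyEq h3).congr_deriv ?_
    rw [h4.fderiv_eq, fderiv_const_smul_field, smul_smul, pow_two]
    rfl

end FinslerMetric

/-! ### The exponential map and the family of geodesics from a point -/

namespace FinslerMetric

open Filter Bundle
open scoped Topology

variable {E : Type*} [NormedAddCommGroup E] [NormedSpace ℝ E]
  {M : Type*} [TopologicalSpace M] [ChartedSpace E M] [IsManifold 𝓘(ℝ, E) ∞ M]
  {F : FinslerMetric E M}

theorem IsUnitTimeGeodesic.apply_zero {x : M} {X : TangentSpace 𝓘(ℝ, E) x} {c : ℝ → M}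
    (hc : F.IsUnitTimeGeodesic x X c) : c 0 = x :=
  congrArg TotalSpace.proj hc.2

theorem Ioo_neg_one_add_mem {δ t : ℝ} (hδ : 0 < δ) (ht : t ∈ Icc (0 : ℝ) 1) :
    t ∈ Ioo (-δ) (1 + δ) :=
  ⟨by linarith [ht.1], by linarith [ht.2]⟩

/-- The choice made in `exp` is immaterial: geodesics with the same initial velocity agree on the
smaller of their two intervals, which contains 1. -/
theorem exp_eq [FiniteDimensional ℝ E] [T2Space M] {x : M}
    {X : TangentSpace 𝓘(ℝ, E) x} {c : ℝ → M} (hc : F.IsUnitTimeGeodesic x X c) : F.exp x X = c 1 := by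
  have hex : ∃ c : ℝ → M, F.IsUnitTimeGeodesic x X c := ⟨c, hc⟩
  have h1 : F.exp x X = hex.choose 1 := dif_pos hex
  rw [h1]
  obtain ⟨⟨δ₁, hδ₁, hg₁⟩, hv₁⟩ := hex.choose_spec
  obtain ⟨⟨δ₂, hδ₂, hg₂⟩, hv₂⟩ := hc
  have hδ : 0 < min δ₁ δ₂ := lt_min hδ₁ hδ₂
  refine (hg₁.mono (Ioo_subset_Ioo ?_ ?_)).eqOn (hg₂.mono (Ioo_subset_Ioo ?_ ?_))
    (s := Ioo (-(min δ₁ δ₂)) (1 + min δ₁ δ₂)) isOpen_Ioo isPreconnected_Ioo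
    (Ioo_neg_one_add_mem hδ (by simp)) (Ioo_neg_one_add_mem hδ (by simp)) (hv₁.trans hv₂.symm)
  · linarith [min_le_left δ₁ δ₂]
  · linarith [min_le_left δ₁ δ₂]
  · linarith [min_le_right δ₁ δ₂]
  · linarith [min_le_right δ₁ δ₂]

/-- The rescaled curve c(r ·) has initial velocity rX. Values of r slightly above 1 are admitted so
that the ray can be differentiated at r = 1. -/
theorem exp_smul_eq [FiniteDimensional ℝ E] [T2Space M] {x : M} {X : E} {c : ℝ → M}
    {δ : ℝ} (hδ : 0 < δ) (hc : F.IsGeodesicOn c (Ioo (-δ) (1 + δ)))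
    (hv : velocityLift c 0 = (⟨x, X⟩ : TangentBundle 𝓘(ℝ, E) M)) {r : ℝ} (hr : 0 < r)
    (hrδ : r < 1 + δ) : F.exp x (r • X) = c r := by
  have hcr := hc.comp_mul isOpen_Ioo hr
  have hc0 : MDifferentiableAt 𝓘(ℝ, ℝ) 𝓘(ℝ, E) c (r * 0) := by
    rw [mul_zero]
    exact (hc.smooth.contMDiffAt (isOpen_Ioo.mem_nhds
      (Ioo_neg_one_add_mem hδ (by simp)))).mdifferentiableAt (by simp)
  have hunit : F.IsUnitTimeGeodesic x (r • X) (fun τ => c (r * τ)) := by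
    -- The rescaled geodesic lives on (-δ/r, (1 + δ)/r); the minimum is the largest symmetric margin
    -- around [0, 1] in this interval.
    refine ⟨⟨min (δ / r) ((1 + δ) / r - 1), lt_min (by positivity) ?_, hcr.mono ?_⟩, ?_⟩
    · rw [sub_pos, one_lt_div hr]
      exact hrδ
    · intro t ht
      have h1 := min_le_left (δ / r) ((1 + δ) / r - 1)
      have h2 := min_le_right (δ / r) ((1 + δ) / r - 1)
      have h3 : r * (δ / r) = δ := by field_simp
      have h4 : r * ((1 + δ) / r) = 1 + δ := by field_simp
      have h5 : -(δ / r) < t := by linarith [ht.1]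
      have h6 : t < (1 + δ) / r := by linarith [ht.2]
      refine ⟨?_, ?_⟩
      · have := mul_lt_mul_of_pos_left h5 hr
        simp only
        linarith
      · have := mul_lt_mul_of_pos_left h6 hr
        simp only
        linarith
    · rw [velocityLift_comp_mul r 0 hc0, mul_zero, hv]
      have : c 0 = x := congrArg TotalSpace.proj hv
      rw [this]
      rfl
  rw [exp_eq hunit, mul_one]

open Classical in
/-- The geodesics `t ↦ c_Y t` issuing from `x`, as a family of curves which is parametrized by
their initial velocities. -/
noncomputable def geodesicFamily (F : FinslerMetric E M) (x : M) (Y : E) (t : ℝ) : M :=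
  if h : ∃ c : ℝ → M, F.IsUnitTimeGeodesic x Y c then h.choose t else x

theorem isUnitTimeGeodesic_geodesicFamily {x : M} {Y : E} (hY : Y ∈ F.expDomain x) :
    F.IsUnitTimeGeodesic x Y (F.geodesicFamily x Y) := by
  obtain ⟨c, hc⟩ := hY
  have hex : ∃ c : ℝ → M, F.IsUnitTimeGeodesic x Y c := ⟨c, hc⟩
  have : F.geodesicFamily x Y = hex.choose := funext fun t => dif_pos hex
  rw [this]
  exact hex.choose_spec

theorem isOpen_openIndicatrix (F : FinslerMetric E M) (x : M) (ε : ℝ) :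
    IsOpen (X := E) (F.openIndicatrix x ε) := by
  have h : Continuous fun v : E => F ⟨x, v⟩ :=
    F.continuous_toFun.comp (FiberBundle.continuous_totalSpaceMk E (TangentSpace 𝓘(ℝ, E)) x)
  exact h.isOpen_preimage (Iio ε) isOpen_Iio

/-- At its own centre the tangent chart leaves vectors unchanged, so the initial data of the
geodesics depend affinely on Y in coordinates. -/
theorem mk_eq_tangentChart_symm (x : M) (Y : E) :
    (⟨x, Y⟩ : TangentBundle 𝓘(ℝ, E) M) = (tangentChart x).symm (extChartAt 𝓘(ℝ, E) x x, Y) := by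
  rw [tangentChart_symm_apply (mem_extChartAt_target x), extChartAt_to_inv]
  have h := mfderivWithin_range_extChartAt_symm (I := 𝓘(ℝ, E)) (x := x)
  simp only [modelWithCornersSelf_coe, range_id, mfderivWithin_univ] at h
  have h2 := congrArg (fun T => T Y) h
  congr 1
  exact h2.symm

theorem IsUnitTimeGeodesic.speed_eq [FiniteDimensional ℝ E] {x : M} {Y : E} {c : ℝ → M}
    (hc : F.IsUnitTimeGeodesic x Y c) {t : ℝ} (ht : t ∈ Icc (0 : ℝ) 1) :
    F (velocityLift c t) = F ⟨x, Y⟩ := by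
  obtain ⟨⟨δ, hδ, hg⟩, hv⟩ := hc
  rw [← hv]
  exact hg.speed_eq isOpen_Ioo isPreconnected_Ioo (Ioo_neg_one_add_mem hδ ht)
    (Ioo_neg_one_add_mem hδ (by simp))

theorem IsUnitTimeGeodesic.velocity_ne_zero [FiniteDimensional ℝ E] {x : M} {Y : E} {c : ℝ → M}
    (hc : F.IsUnitTimeGeodesic x Y c) (hY : Y ≠ 0) {t : ℝ} (ht : t ∈ Icc (0 : ℝ) 1) :
    (velocityLift (E := E) c t).2 ≠ 0 := by
  rw [← (F.apply_eq_zero_iff _).ne, hc.speed_eq ht]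
  exact (F.pos x Y hY).ne'

theorem tangentChart_mk_self (x : M) (Y : E) :
    tangentChart x (⟨x, Y⟩ : TangentBundle 𝓘(ℝ, E) M) = (extChartAt 𝓘(ℝ, E) x x, Y) := by
  rw [mk_eq_tangentChart_symm, (tangentChart x).right_inv
    (mem_tangentChart_target.2 (mem_extChartAt_target x))]

end FinslerMetric

/-! ### First variation along the family of geodesics -/

namespace FinslerMetric

open Filter Bundle
open scoped Topology NNReal

variable {E : Type*} [NormedAddCommGroup E] [NormedSpace ℝ E]
  {M : Type*} [TopologicalSpace M] [ChartedSpace E M] [IsManifold 𝓘(ℝ, E) ∞ M]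
  {F : FinslerMetric E M}

theorem mdifferentiableAt_proj_comp {γ : E → TangentBundle 𝓘(ℝ, E) M} {X : E}
    (h : MDifferentiableAt 𝓘(ℝ, E) 𝓘(ℝ, E).tangent γ X) :
    MDifferentiableAt 𝓘(ℝ, E) 𝓘(ℝ, E) (fun Y => (γ Y).1) X :=
  MDifferentiableAt.comp (g := TotalSpace.proj) X
    ((contMDiff_proj (n := 1) (IB := 𝓘(ℝ, E)) (TangentSpace 𝓘(ℝ, E) (M := M))
      (γ X)).mdifferentiableAt one_ne_zero) h

theorem differentiableAt_tangentChart_comp {γ : E → TangentBundle 𝓘(ℝ, E) M} {X : E} {a : M}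
    (h : MDifferentiableAt 𝓘(ℝ, E) 𝓘(ℝ, E).tangent γ X)
    (ha : (γ X).1 ∈ (extChartAt 𝓘(ℝ, E) a).source) :
    DifferentiableAt ℝ (fun Y => tangentChart a (γ Y)) X := by
  rw [← mdifferentiableAt_iff_differentiableAt]
  have : IsManifold 𝓘(ℝ, E).tangent 1 (TangentBundle 𝓘(ℝ, E) M) := .of_le (n := ∞) (by norm_cast)
  have h1 := mem_tangentChart_source.2 ha
  rw [tangentChart, extChartAt_source] at h1
  exact (mdifferentiableAt_extChartAt (I := 𝓘(ℝ, E).tangent) h1).comp X h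

theorem mdifferentiableAt_tangentChart_symm_comp {ζ : E → E × E} {X : E} {a : M}
    (h : DifferentiableAt ℝ ζ X) (ha : (ζ X).1 ∈ (extChartAt 𝓘(ℝ, E) a).target) :
    MDifferentiableAt 𝓘(ℝ, E) 𝓘(ℝ, E).tangent (fun Y => (tangentChart a).symm (ζ Y)) X := by
  have : IsManifold 𝓘(ℝ, E).tangent 1 (TangentBundle 𝓘(ℝ, E) M) := .of_le (n := ∞) (by norm_cast)
  have h1 := (contMDiffOn_extChartAt_symm (n := 1) (I := 𝓘(ℝ, E).tangent)
    (⟨a, 0⟩ : TangentBundle 𝓘(ℝ, E) M)).contMDiffAt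
    ((isOpen_extChartAt_target (I := 𝓘(ℝ, E).tangent) _).mem_nhds (mem_tangentChart_target.2 ha))
  exact (h1.mdifferentiableAt one_ne_zero).comp X h.mdifferentiableAt

variable (F) in
/-- The derivative of the energy at the velocity of the curve `c_X`, applied to the variation field
of the family `c` in the direction `q`. -/
noncomputable def velocityPairing (c : E → ℝ → M) (X : E) (t : ℝ) (q : E) : ℝ :=
  fderiv ℝ (fun v : E => F ⟨c X t, v⟩ ^ 2 / 2) ((velocityLift (E := E) (c X) t).2 : E)
    (mfderiv 𝓘(ℝ, E) 𝓘(ℝ, E) (fun Y => c Y t) X q)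

/-- The left side does not involve a chart, so increments computed in different charts along the
geodesic can be added. -/
theorem velocityPairing_eq_momentum {c : E → ℝ → M} {X : E} {t : ℝ} {a : M}
    (h : MDifferentiableAt 𝓘(ℝ, E) 𝓘(ℝ, E).tangent (fun Y => velocityLift (E := E) (c Y) t) X)
    (ha : c X t ∈ (extChartAt 𝓘(ℝ, E) a).source)
    (hv : (velocityLift (E := E) (c X) t).2 ≠ 0) (q : E) :
    F.velocityPairing c X t q =
      momentum (F.localEnergy a) (tangentChart a (velocityLift (E := E) (c X) t))
        (fderiv ℝ (fun Y => tangentChart a (velocityLift (E := E) (c Y) t)) X q).1 := by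
  have hc : MDifferentiableAt 𝓘(ℝ, E) 𝓘(ℝ, E) (fun Y => c Y t) X := mdifferentiableAt_proj_comp h
  have hd := differentiableAt_tangentChart_comp h ha
  have h1 : (fderiv ℝ (fun Y => tangentChart a (velocityLift (E := E) (c Y) t)) X q).1 =
      fderiv ℝ (fun Y => extChartAt 𝓘(ℝ, E) a (c Y t)) X q := by
    have : HasFDerivAt (fun Y => extChartAt 𝓘(ℝ, E) a (c Y t))
        ((ContinuousLinearMap.fst ℝ E E).comp
          (fderiv ℝ (fun Y => tangentChart a (velocityLift (E := E) (c Y) t)) X)) X :=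
      (ContinuousLinearMap.fst ℝ E E).hasFDerivAt.comp X hd.hasFDerivAt
    rw [this.fderiv]
    rfl
  have ha' := ha
  rw [extChartAt_source] at ha'
  have : IsManifold 𝓘(ℝ, E) 1 M := .of_le (n := ∞) (by norm_cast)
  have h2 := mfderiv_comp X (mdifferentiableAt_extChartAt (I := 𝓘(ℝ, E)) ha') hc
  rw [mfderiv_eq_fderiv] at h2
  have h3 := congrArg (fun T => T q) h2
  refine (F.fderiv_energy_eq_momentum ha hv _).trans ?_
  rw [h1]
  exact congrArg (momentum (F.localEnergy a) (tangentChart a (velocityLift (E := E) (c X) t))) h3.symm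

theorem mdifferentiableAt_velocityLift_zero {c : E → ℝ → M} {x : M} {X : E}
    (hc : ∀ᶠ Y in 𝓝 X, F.IsUnitTimeGeodesic x Y (c Y)) :
    MDifferentiableAt 𝓘(ℝ, E) 𝓘(ℝ, E).tangent (fun Y => velocityLift (E := E) (c Y) 0) X := by
  refine (mdifferentiableAt_tangentChart_symm_comp (a := x)
    (ζ := fun Y => (extChartAt 𝓘(ℝ, E) x x, Y)) (by fun_prop)
    (mem_extChartAt_target x)).congr_of_eventuallyEq ?_
  filter_upwards [hc] with Y hY
  rw [hY.2]
  exact mk_eq_tangentChart_symm x Y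

theorem velocityPairing_zero {c : E → ℝ → M} {x : M} {X : E}
    (hc : ∀ᶠ Y in 𝓝 X, F.IsUnitTimeGeodesic x Y (c Y)) (q : E) :
    F.velocityPairing c X 0 q = 0 := by
  have h1 : (fun Y => c Y 0) =ᶠ[𝓝 X] fun _ => x := hc.mono fun Y hY => hY.apply_zero
  have h2 : (mfderiv 𝓘(ℝ, E) 𝓘(ℝ, E) (fun Y => c Y 0) X : E →L[ℝ] E) = 0 := by
    rw [h1.mfderiv_eq]
    exact mfderiv_const
  rw [velocityPairing]
  refine (congrArg _ (congrArg (fun T : E →L[ℝ] E => T q) h2)).trans ?_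
  exact map_zero _

variable [FiniteDimensional ℝ E] [T2Space M]

/-- Along a differentiable family of geodesics, differentiability and the first variation formula
propagate locally in time. -/
theorem exists_forward_propagation {c : E → ℝ → M} {x : M} {X : E} (hX : X ≠ 0)
    (hc : ∀ᶠ Y in 𝓝 X, F.IsUnitTimeGeodesic x Y (c Y)) {t₀ : ℝ} (ht₀ : t₀ ∈ Icc (0 : ℝ) 1) :
    ∃ η > 0, ∀ t₁ ∈ Icc (0 : ℝ) 1, ∀ t₂ ∈ Icc (0 : ℝ) 1, |t₁ - t₀| < η → |t₂ - t₀| < η → t₁ ≤ t₂ →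
      MDifferentiableAt 𝓘(ℝ, E) 𝓘(ℝ, E).tangent (fun Y => velocityLift (E := E) (c Y) t₁) X →
      MDifferentiableAt 𝓘(ℝ, E) 𝓘(ℝ, E).tangent (fun Y => velocityLift (E := E) (c Y) t₂) X ∧
      ∀ q, F.velocityPairing c X t₂ q - F.velocityPairing c X t₁ q =
        (t₂ - t₁) * fderiv ℝ (fun Y : E => F ⟨x, Y⟩ ^ 2 / 2) X q := by
  have : T2Space (TangentBundle 𝓘(ℝ, E) M) := t2Space_totalSpace
  have : ProperSpace (E × E) := FiniteDimensional.proper ℝ (E × E)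
  have hcX := hc.self_of_nhds
  set a := c X t₀ with ha_def
  set L := F.localEnergy a with hL_def
  have hL := F.isChartEnergy_localEnergy a
  have ha : c X t₀ ∈ (extChartAt 𝓘(ℝ, E) a).source :=
    mem_extChartAt_source (I := 𝓘(ℝ, E)) (c X t₀)
  set z₀ := tangentChart a (velocityLift (E := E) (c X) t₀) with hz₀_def
  have hz₀ : z₀ ∈ (extChartAt 𝓘(ℝ, E) a).target ×ˢ ({0}ᶜ : Set E) :=
    tangentChart_mem_prod (p := velocityLift (E := E) (c X) t₀) ha (hcX.velocity_ne_zero hX ht₀)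
  obtain ⟨r, hr, hball⟩ := Metric.nhds_basis_closedBall.mem_iff.1 (hL.isOpen_prod.mem_nhds hz₀)
  have hcpt := isCompact_closedBall z₀ r
  have hcd : ∀ z ∈ Metric.closedBall z₀ r, ContDiffAt ℝ 1 (spray L) z := fun z hz =>
    hL.contDiffAt_spray (hball hz)
  obtain ⟨C, hC⟩ := hcpt.exists_bound_of_continuousOn (f := spray L)
    fun z hz => (hcd z hz).continuousAt.continuousWithinAt
  obtain ⟨K', hK'⟩ := hcpt.exists_bound_of_continuousOn (f := fderiv ℝ (spray L))
    fun z hz => ((hcd z hz).continuousAt_fderiv one_ne_zero).continuousWithinAt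
  have hC0 : 0 ≤ C := (norm_nonneg _).trans (hC z₀ (Metric.mem_closedBall_self hr.le))
  have hK'0 : 0 ≤ K' := (norm_nonneg _).trans (hK' z₀ (Metric.mem_closedBall_self hr.le))
  set K : ℝ≥0 := ⟨K', hK'0⟩ with hK_def
  have hK : ∀ z ∈ Metric.closedBall z₀ r, ‖fderiv ℝ (spray L) z‖ ≤ K := hK'
  have hψ : ContinuousOn (tangentChart a) (tangentChart a).source :=
    continuousOn_extChartAt (I := 𝓘(ℝ, E).tangent) _
  have hψs : IsOpen (tangentChart a).source :=
    isOpen_extChartAt_source (I := 𝓘(ℝ, E).tangent) _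
  have hnear : ∀ ρ > 0, IsOpen ((tangentChart a).source ∩ tangentChart a ⁻¹' Metric.ball z₀ ρ) :=
    fun ρ _ => hψ.isOpen_inter_preimage hψs Metric.isOpen_ball
  have hev : ∀ᶠ t in 𝓝 t₀, velocityLift (E := E) (c X) t ∈
      (tangentChart a).source ∩ tangentChart a ⁻¹' Metric.ball z₀ (r / 2) := by
    obtain ⟨⟨δ, hδ, hg⟩, hv⟩ := hcX
    exact (hg.continuousAt_velocityLift isOpen_Ioo (Ioo_neg_one_add_mem hδ ht₀)).preimage_mem_nhds
      ((hnear _ (half_pos hr)).mem_nhds ⟨mem_tangentChart_source.2 ha,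
        Metric.mem_ball_self (half_pos hr)⟩)
  obtain ⟨η₀, hη₀, hη⟩ := Metric.eventually_nhds_iff.1 hev
  -- Two times within η of t₀ differ by less than 2η. The second bound lets a solution move by less
  -- than r / 2, so that from the half ball it stays in the ball of radius r; the third gives K(t₂ -
  -- t₁) ≤ 1/2, as required by `differentiableAt_of_ode`.
  refine ⟨min η₀ (min (r / (8 * (C + 1))) (1 / (4 * (K' + 1)))), by positivity, ?_⟩
  intro t₁ ht₁ t₂ ht₂ h₁ h₂ h₁₂ hd
  have hlen : t₂ - t₁ < 2 * min η₀ (min (r / (8 * (C + 1))) (1 / (4 * (K' + 1)))) := by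
    rw [abs_lt] at h₁ h₂
    linarith
  have hlenC : C * (t₂ - t₁) < r / 2 := by
    have h3 : t₂ - t₁ < 2 * (r / (8 * (C + 1))) := hlen.trans_le
      (by gcongr; exact (min_le_right _ _).trans (min_le_left _ _))
    calc C * (t₂ - t₁) ≤ (C + 1) * (t₂ - t₁) := by
          apply mul_le_mul_of_nonneg_right <;> linarith
      _ ≤ (C + 1) * (2 * (r / (8 * (C + 1)))) := by gcongr
      _ = r / 4 := by field_simp; norm_num
      _ < r / 2 := by linarith
  have hlenK : K * (t₂ - t₁) ≤ 1 / 2 := by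
    have h3 : t₂ - t₁ < 2 * (1 / (4 * (K' + 1))) := hlen.trans_le
      (by gcongr; exact (min_le_right _ _).trans (min_le_right _ _))
    calc K' * (t₂ - t₁) ≤ (K' + 1) * (t₂ - t₁) := by
          apply mul_le_mul_of_nonneg_right <;> linarith
      _ ≤ (K' + 1) * (2 * (1 / (4 * (K' + 1)))) := by gcongr
      _ = 1 / 2 := by field_simp; norm_num
  have hsub : Icc t₁ t₂ ⊆ Icc 0 1 := Icc_subset_Icc ht₁.1 ht₂.2
  have hXt₁ := hη (show dist t₁ t₀ < η₀ from h₁.trans_le (min_le_left _ _))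
  have hev₁ : ∀ᶠ Y in 𝓝 X, velocityLift (E := E) (c Y) t₁ ∈
      (tangentChart a).source ∩ tangentChart a ⁻¹' Metric.ball z₀ (r / 2) :=
    hd.continuousAt.preimage_mem_nhds ((hnear _ (half_pos hr)).mem_nhds hXt₁)
  have hne : ∀ᶠ Y in 𝓝 X, Y ≠ 0 := isOpen_ne.mem_nhds hX
  have hstay : ∀ᶠ Y in 𝓝 X, ∀ t ∈ Icc t₁ t₂, velocityLift (E := E) (c Y) t ∈ (tangentChart a).source ∧
      tangentChart a (velocityLift (E := E) (c Y) t) ∈ Metric.closedBall z₀ r ∧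
      HasDerivAt (fun τ => tangentChart a (velocityLift (E := E) (c Y) τ))
        (spray L (tangentChart a (velocityLift (E := E) (c Y) t))) t := by
    filter_upwards [hev₁, hne, hc] with Y hY₁ hY0 hYg
    obtain ⟨δ, hδ, hg⟩ := hYg.1
    have hder : ∀ t ∈ Icc t₁ t₂, velocityLift (E := E) (c Y) t ∈ (tangentChart a).source →
        HasDerivAt (fun τ => tangentChart a (velocityLift (E := E) (c Y) τ))
        (spray L (tangentChart a (velocityLift (E := E) (c Y) t))) t := fun t ht hs =>
      hg.hasDerivAt_tangentChart isOpen_Ioo (Ioo_neg_one_add_mem hδ (hsub ht))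
        (hYg.velocity_ne_zero hY0 (hsub ht)) (mem_tangentChart_source.1 hs)
    -- Bootstrap: as long as the lift has stayed in the closed ball, its speed is at most C, which
    -- places it in the open ball.
    have key := (tangentChart a).forall_mem_of_forall_mem hψs hψ
      (continuousOn_extChartAt_symm (I := 𝓘(ℝ, E).tangent) _) hcpt
      (fun z hz => mem_tangentChart_target.2 (hball hz).1) Metric.isOpen_ball
      Metric.ball_subset_closedBall (γ := velocityLift (E := E) (c Y)) (t₁ := t₁) (t₂ := t₂)
      (fun t ht => hg.continuousAt_velocityLift isOpen_Ioo (Ioo_neg_one_add_mem hδ (hsub ht)))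
      hY₁.1 (Metric.ball_subset_closedBall (Metric.ball_subset_ball (by linarith) hY₁.2))
      (fun t ht hτ => by
        have hsub' : Icc t₁ t ⊆ Icc t₁ t₂ := Icc_subset_Icc_right ht.2
        have h3 := (convex_Icc t₁ t).norm_image_sub_le_of_norm_hasDerivWithin_le
          (fun τ hτ' => (hder τ (hsub' hτ') (hτ τ hτ').1).hasDerivWithinAt)
          (fun τ hτ' => hC _ (hτ τ hτ').2) (left_mem_Icc.2 ht.1) (right_mem_Icc.2 ht.1)
        rw [Real.norm_of_nonneg (by linarith [ht.1] : (0 : ℝ) ≤ t - t₁), ← dist_eq_norm] at h3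
        have h4 : C * (t - t₁) ≤ C * (t₂ - t₁) :=
          mul_le_mul_of_nonneg_left (by linarith [ht.2]) hC0
        have h5 := Metric.mem_ball.1 hY₁.2
        have h6 := dist_triangle (tangentChart a (velocityLift (E := E) (c Y) t))
          (tangentChart a (velocityLift (E := E) (c Y) t₁)) z₀
        rw [Metric.mem_ball]
        linarith)
    exact fun t ht => ⟨(key t ht).1, (key t ht).2, hder t ht (key t ht).1⟩
  have hode : ∀ᶠ Y in 𝓝 X, ∀ t ∈ Icc t₁ t₂,
      tangentChart a (velocityLift (E := E) (c Y) t) ∈ Metric.closedBall z₀ r ∧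
      HasDerivAt (fun τ => tangentChart a (velocityLift (E := E) (c Y) τ))
        (spray L (tangentChart a (velocityLift (E := E) (c Y) t))) t :=
    hstay.mono fun Y hY t ht => (hY t ht).2
  have hd₁ := differentiableAt_tangentChart_comp hd (mem_tangentChart_source.1 hXt₁.1)
  have hd₂ : DifferentiableAt ℝ (fun Y => tangentChart a (velocityLift (E := E) (c Y) t₂)) X :=
    differentiableAt_of_ode (z := fun Y t => tangentChart a (velocityLift (E := E) (c Y) t)) hcd hK h₁₂ hlenK
      hode hd₁
  have hXt₂ := hstay.self_of_nhds t₂ (right_mem_Icc.2 h₁₂)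
  have hdd : MDifferentiableAt 𝓘(ℝ, E) 𝓘(ℝ, E).tangent
      (fun Y => velocityLift (E := E) (c Y) t₂) X := by
    refine (mdifferentiableAt_tangentChart_symm_comp (a := a) hd₂
      ((extChartAt 𝓘(ℝ, E) a).map_source
        (mem_tangentChart_source.1 hXt₂.1))).congr_of_eventuallyEq ?_
    filter_upwards [hstay] with Y hY
    exact ((tangentChart a).left_inv (hY t₂ (right_mem_Icc.2 h₁₂)).1).symm
  refine ⟨hdd, fun q => ?_⟩
  rw [velocityPairing_eq_momentum hd (mem_tangentChart_source.1 hXt₁.1) (hcX.velocity_ne_zero hX ht₁),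
    velocityPairing_eq_momentum hdd (mem_tangentChart_source.1 hXt₂.1) (hcX.velocity_ne_zero hX ht₂),
    hL.momentum_variation (z := fun Y t => tangentChart a (velocityLift (E := E) (c Y) t)) hball hK h₁₂ hode
      hd₁ hd₂ q]
  -- The energy at time t₁ equals the energy of the initial vector Y, so its differential in Y is
  -- the same at every time.
  congr 2
  refine Filter.EventuallyEq.fderiv_eq ?_
  filter_upwards [hev₁, hc] with Y hY hYg
  rw [F.localEnergy_tangentChart (mem_tangentChart_source.1 hY.1), hYg.speed_eq ht₁]

end FinslerMetric

/-! ### Differentiability at the origin, radial derivative, and the formula at time one -/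

namespace IsChartEnergy

variable {E : Type*} [NormedAddCommGroup E] [NormedSpace ℝ E] [FiniteDimensional ℝ E]
  {U : Set E} {L : E → E → ℝ}

/-- Locally, a Finsler energy is comparable to the square of the norm. -/
theorem exists_bounds (h : IsChartEnergy U L) {u₀ : E} {ρ : ℝ} (hρ : Metric.closedBall u₀ ρ ⊆ U) :
    ∃ m > 0, ∃ B > 0, ∀ u ∈ Metric.closedBall u₀ ρ, ∀ v ≠ 0,
      m * ‖v‖ ^ 2 ≤ L u v ∧ L u v ≤ B * ‖v‖ ^ 2 := by
  have : ProperSpace E := FiniteDimensional.proper ℝ E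
  have hcpt : IsCompact (Metric.closedBall u₀ ρ ×ˢ Metric.sphere (0 : E) 1) :=
    (isCompact_closedBall u₀ ρ).prod (isCompact_sphere 0 1)
  have hne : ∀ v ∈ Metric.sphere (0 : E) 1, v ≠ 0 := fun v hv =>
    ne_zero_of_mem_unit_sphere ⟨v, hv⟩
  have hcont : ContinuousOn (Function.uncurry L)
      (Metric.closedBall u₀ ρ ×ˢ Metric.sphere (0 : E) 1) :=
    h.contDiffOn.continuousOn.mono (prod_mono hρ fun v hv => hne v hv)
  obtain ⟨m, hm, hmb⟩ := hcpt.exists_forall_le' hcont (a := 0)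
    fun z hz => h.pos z.1 (hρ hz.1) z.2 (hne _ hz.2)
  obtain ⟨B, hB⟩ := hcpt.exists_bound_of_continuousOn hcont
  refine ⟨m, hm, |B| + 1, by positivity, fun u hu v hv => ?_⟩
  have hv0 : 0 < ‖v‖ := norm_pos_iff.2 hv
  have hvs : ‖v‖⁻¹ • v ∈ Metric.sphere (0 : E) 1 := by
    rw [mem_sphere_zero_iff_norm, norm_smul, norm_inv, norm_norm, inv_mul_cancel₀ hv0.ne']
  have h1 := h.homogeneous u (hρ hu) ‖v‖ hv0 (‖v‖⁻¹ • v)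
  rw [smul_inv_smul₀ hv0.ne'] at h1
  have h2 : m ≤ L u (‖v‖⁻¹ • v) := hmb (u, ‖v‖⁻¹ • v) ⟨hu, hvs⟩
  have h3 : ‖L u (‖v‖⁻¹ • v)‖ ≤ B := hB (u, ‖v‖⁻¹ • v) ⟨hu, hvs⟩
  have h4 := (Real.le_norm_self _).trans (h3.trans (le_abs_self B))
  rw [h1]
  constructor
  · rw [mul_comm]
    gcongr
  · rw [mul_comm (|B| + 1)]
    gcongr
    linarith

end IsChartEnergy

namespace FinslerMetric

open Filter Bundle
open scoped Topology NNReal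

variable {E : Type*} [NormedAddCommGroup E] [NormedSpace ℝ E] [FiniteDimensional ℝ E]
  {M : Type*} [TopologicalSpace M] [T2Space M] [ChartedSpace E M] [IsManifold 𝓘(ℝ, E) ∞ M]
  {F : FinslerMetric E M}

theorem exp_zero {x : M} (h : (0 : E) ∈ F.expDomain x) : F.exp x 0 = x := by
  obtain ⟨c, hc⟩ := h
  rw [exp_eq hc]
  obtain ⟨⟨δ, hδ, hg⟩, hv⟩ := hc
  have h0 : (velocityLift (E := E) c 0).2 = 0 := by
    rw [← F.apply_eq_zero_iff, hv]
    exact F.apply_zero x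
  rw [hg.eqOn_const isOpen_Ioo isPreconnected_Ioo (Ioo_neg_one_add_mem hδ (by simp))
    (Ioo_neg_one_add_mem hδ (by simp)) h0]
  exact congrArg TotalSpace.proj hv

/-- Second order expansion of short geodesics in a chart. -/
theorem exists_norm_extChartAt_geodesic_sub_le {x : M} {ε : ℝ} (hε : 0 < ε)
    (hdom : F.openIndicatrix x ε ⊆ F.expDomain x) :
    ∃ δ > 0, ∃ C, ∀ Y : E, ‖Y‖ = δ → ∀ s ∈ Ioc (0 : ℝ) 1,
      F.exp x (s • Y) ∈ (extChartAt 𝓘(ℝ, E) x).source ∧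
      ‖extChartAt 𝓘(ℝ, E) x (F.exp x (s • Y)) - extChartAt 𝓘(ℝ, E) x x - s • Y‖ ≤ C * s ^ 2 := by
  have : ProperSpace E := FiniteDimensional.proper ℝ E
  set φ := extChartAt 𝓘(ℝ, E) x with hφ
  set L := F.localEnergy x with hL_def
  have hL : IsChartEnergy φ.target L := F.isChartEnergy_localEnergy x
  obtain ⟨ρ, hρ, hball⟩ := Metric.nhds_basis_closedBall.mem_iff.1
    (hL.isOpen.mem_nhds (mem_extChartAt_target (I := 𝓘(ℝ, E)) x))
  obtain ⟨m, hm, B, hB, hmB⟩ := hL.exists_bounds hball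
  have hind : F.openIndicatrix x ε ∈ 𝓝 (0 : E) := (F.isOpen_openIndicatrix x ε).mem_nhds
    (show F ⟨x, (0 : TangentSpace 𝓘(ℝ, E) x)⟩ < ε by rwa [F.apply_zero])
  obtain ⟨δ₀, hδ₀, hδball⟩ := Metric.mem_nhds_iff.1 hind
  have hκ : 0 < √(B / m) := Real.sqrt_pos.2 (by positivity)
  -- The first bound puts Y in the indicatrix. By conservation of energy m‖v‖² ≤ L ≤ Bδ², so ‖v‖ ≤
  -- √(B/m) δ, which the second bound makes at most ρ/2: in unit time the geodesic cannot leave the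
  -- ball of radius ρ.
  set δ := min (δ₀ / 2) (ρ / (2 * √(B / m))) with hδ_def
  have hδ : 0 < δ := by positivity
  have hδρ : √(B / m) * δ ≤ ρ / 2 := by
    calc √(B / m) * δ ≤ √(B / m) * (ρ / (2 * √(B / m))) := by gcongr; exact min_le_right _ _
      _ = ρ / 2 := by field_simp
  -- Energy is also bounded below, mδ² ≤ L ≤ B‖v‖². The lifts of all these geodesics hence lie in a
  -- compact set off the zero section, where the spray has a bound C independent of Y.
  set A : Set (E × E) := Metric.closedBall (φ x) ρ ×ˢ
    (Metric.closedBall (0 : E) (√(B / m) * δ) \ Metric.ball 0 (√(m / B) * δ)) with hA_def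
  have hAcpt : IsCompact A :=
    (isCompact_closedBall _ _).prod ((isCompact_closedBall _ _).diff Metric.isOpen_ball)
  have hAsub : A ⊆ φ.target ×ˢ ({0}ᶜ : Set E) := by
    refine prod_mono hball fun v hv h0 => hv.2 ?_
    rw [mem_singleton_iff.1 h0]
    exact Metric.mem_ball_self (mul_pos (Real.sqrt_pos.2 (by positivity)) hδ)
  obtain ⟨C, hC⟩ := hAcpt.exists_bound_of_continuousOn (f := spray L)
    fun z hz => (hL.contDiffAt_spray (hAsub hz)).continuousAt.continuousWithinAt
  refine ⟨δ, hδ, C, fun Y hY => ?_⟩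
  have hY0 : Y ≠ 0 := norm_pos_iff.1 (hY ▸ hδ)
  have hYdom : Y ∈ F.expDomain x := hdom (hδball (by
    rw [mem_ball_zero_iff, hY]
    have := min_le_left (δ₀ / 2) (ρ / (2 * √(B / m)))
    linarith))
  obtain ⟨c, hc⟩ := hYdom
  obtain ⟨⟨δ', hδ', hg⟩, hv⟩ := id hc
  have hc0 : c 0 = x := hc.apply_zero
  set z : ℝ → E × E := fun t => tangentChart x (velocityLift (E := E) c t) with hz_def
  have hz0 : z 0 = (φ x, Y) := by
    simp only [hz_def, hv]
    exact tangentChart_mk_self x Y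
  have hz1 : ∀ t, c t ∈ φ.source → (z t).1 = φ (c t) := fun t ht =>
    congrArg Prod.fst (tangentChart_apply (p := velocityLift (E := E) c t) ht)
  have hzder : ∀ t ∈ Icc (0 : ℝ) 1, c t ∈ φ.source → HasDerivAt z (spray L (z t)) t :=
    fun t ht hs => hg.hasDerivAt_tangentChart isOpen_Ioo (Ioo_neg_one_add_mem hδ' ht)
      (hc.velocity_ne_zero hY0 ht) hs
  have hzA : ∀ t ∈ Icc (0 : ℝ) 1, c t ∈ φ.source → φ (c t) ∈ Metric.closedBall (φ x) ρ →
      z t ∈ A := by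
    intro t ht hs hb
    have hv0 : (z t).2 ≠ 0 := (snd_tangentChart_eq_zero_iff (p := velocityLift (E := E) c t) hs).not.2
      (hc.velocity_ne_zero hY0 ht)
    have hE : L (z t).1 (z t).2 = L (φ x) Y := by
      have h1 := F.localEnergy_tangentChart (p := velocityLift (E := E) c t) (a := x) hs
      have h2 := F.localEnergy_tangentChart (p := (⟨x, Y⟩ : TangentBundle 𝓘(ℝ, E) M)) (a := x)
        (mem_extChartAt_source (I := 𝓘(ℝ, E)) x)
      rw [hc.speed_eq ht, ← h2, tangentChart_mk_self] at h1
      exact h1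
    have hb' : (z t).1 ∈ Metric.closedBall (φ x) ρ := by rwa [hz1 t hs]
    obtain ⟨h1, h2⟩ := hmB _ hb' _ hv0
    obtain ⟨h3, h4⟩ := hmB _ (Metric.mem_closedBall_self hρ.le) _ hY0
    rw [hE] at h1 h2
    rw [hY] at h3 h4
    refine ⟨hb', ?_, ?_⟩
    · rw [mem_closedBall_zero_iff]
      refine abs_le_of_sq_le_sq' ?_ (by positivity) |>.2
      rw [mul_pow, Real.sq_sqrt (by positivity), div_mul_eq_mul_div, le_div_iff₀ hm]
      linarith
    · rw [mem_ball_zero_iff, not_lt]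
      refine abs_le_of_sq_le_sq' ?_ (by positivity) |>.2
      rw [mul_pow, Real.sq_sqrt (by positivity), div_mul_eq_mul_div, div_le_iff₀ hB]
      linarith
  have hstay := φ.forall_mem_of_forall_mem (isOpen_extChartAt_source x) (continuousOn_extChartAt x)
    (continuousOn_extChartAt_symm x) (isCompact_closedBall (φ x) ρ) hball Metric.isOpen_ball
    Metric.ball_subset_closedBall (γ := c) (t₁ := 0) (t₂ := 1)
    (fun t ht => (hg.smooth.contMDiffAt
      (isOpen_Ioo.mem_nhds (Ioo_neg_one_add_mem hδ' ht))).continuousAt)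
    (by rw [hc0]; exact mem_extChartAt_source (I := 𝓘(ℝ, E)) x)
    (by rw [hc0]; exact Metric.mem_closedBall_self hρ.le)
    (fun t ht hτ => by
      have hsub : Icc 0 t ⊆ Icc (0 : ℝ) 1 := Icc_subset_Icc_right ht.2
      have h3 := (convex_Icc 0 t).norm_image_sub_le_of_norm_hasDerivWithin_le
        (f := fun τ => (z τ).1) (f' := fun τ => (z τ).2) (C := ρ / 2)
        (fun τ hτ' => ((ContinuousLinearMap.fst ℝ E E).hasFDerivAt.comp_hasDerivAt τ
          (hzder τ (hsub hτ') (hτ τ hτ').1)).hasDerivWithinAt)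
        (fun τ hτ' => by
          have h4 := (hzA τ (hsub hτ') (hτ τ hτ').1 (hτ τ hτ').2).2.1
          rw [mem_closedBall_zero_iff] at h4
          exact h4.trans hδρ)
        (left_mem_Icc.2 ht.1) (right_mem_Icc.2 ht.1)
      simp only [hz0, hz1 t (hτ t (right_mem_Icc.2 ht.1)).1] at h3
      rw [sub_zero, Real.norm_of_nonneg ht.1] at h3
      rw [Metric.mem_ball, dist_eq_norm]
      have : ρ / 2 * t ≤ ρ / 2 * 1 := by gcongr; exact ht.2
      linarith)
  intro s hs
  have hs' : s ∈ Icc (0 : ℝ) 1 := ⟨hs.1.le, hs.2⟩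
  have hexp : F.exp x (s • Y) = c s :=
    exp_smul_eq hδ' hg hv hs.1 (by linarith [hs.2])
  rw [hexp]
  refine ⟨(hstay s hs').1, ?_⟩
  have hsub : Icc 0 s ⊆ Icc (0 : ℝ) 1 := Icc_subset_Icc_right hs.2
  have hC0 : 0 ≤ C := (norm_nonneg _).trans (hC _ (hzA s hs' (hstay s hs').1 (hstay s hs').2))
  have hvel : ∀ t ∈ Icc 0 s, ‖(z t).2 - Y‖ ≤ C * s := by
    intro t ht
    have h3 := (convex_Icc 0 t).norm_image_sub_le_of_norm_hasDerivWithin_le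
      (f := z) (C := C)
      (fun τ hτ' => (hzder τ (hsub ⟨hτ'.1, hτ'.2.trans ht.2⟩)
        (hstay τ (hsub ⟨hτ'.1, hτ'.2.trans ht.2⟩)).1).hasDerivWithinAt)
      (fun τ hτ' => by
        have hτ := hsub ⟨hτ'.1, hτ'.2.trans ht.2⟩
        exact hC _ (hzA τ hτ (hstay τ hτ).1 (hstay τ hτ).2))
      (left_mem_Icc.2 ht.1) (right_mem_Icc.2 ht.1)
    rw [sub_zero, Real.norm_of_nonneg ht.1, hz0] at h3
    have h4 : ‖(z t).2 - Y‖ ≤ ‖z t - (φ x, Y)‖ := norm_snd_le (z t - (φ x, Y))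
    exact h4.trans (h3.trans (mul_le_mul_of_nonneg_left ht.2 hC0))
  -- On [0, s] the velocity differs from Y by at most Cs; integrating once more gives the quadratic
  -- error.
  have h5 := (convex_Icc 0 s).norm_image_sub_le_of_norm_hasDerivWithin_le
    (f := fun τ => (z τ).1 - τ • Y) (f' := fun τ => (z τ).2 - Y) (C := C * s)
    (fun τ hτ => (((ContinuousLinearMap.fst ℝ E E).hasFDerivAt.comp_hasDerivAt τ
      (hzder τ (hsub hτ) (hstay τ (hsub hτ)).1)).sub
        (((hasDerivAt_id τ).smul_const Y).congr_deriv (one_smul ℝ Y))).hasDerivWithinAt)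
    hvel (left_mem_Icc.2 hs.1.le) (right_mem_Icc.2 hs.1.le)
  simp only [hz0, hz1 s (hstay s hs').1, zero_smul, sub_zero] at h5
  rw [Real.norm_of_nonneg hs.1.le] at h5
  calc ‖φ (c s) - φ x - s • Y‖ = ‖φ (c s) - s • Y - φ x‖ := by congr 1; abel
    _ ≤ C * s * s := h5
    _ = C * s ^ 2 := by ring

/-- The exponential map is differentiable at the origin. -/
theorem mdifferentiableAt_exp_zero {x : M} {ε : ℝ} (hε : 0 < ε)
    (hdom : F.openIndicatrix x ε ⊆ F.expDomain x) :
    MDifferentiableAt 𝓘(ℝ, E) 𝓘(ℝ, E) (F.exp x) (0 : E) := by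
  obtain ⟨δ, hδ, C, hC⟩ := exists_norm_extChartAt_geodesic_sub_le hε hdom
  have hexp0 : F.exp x 0 = x := exp_zero (hdom (by
    show F ⟨x, (0 : TangentSpace 𝓘(ℝ, E) x)⟩ < ε
    rwa [F.apply_zero]))
  have hbound : ∀ w : E, ‖w‖ < δ → F.exp x w ∈ (extChartAt 𝓘(ℝ, E) x).source ∧
      ‖extChartAt 𝓘(ℝ, E) x (F.exp x w) - extChartAt 𝓘(ℝ, E) x x - w‖ ≤
        C / δ ^ 2 * ‖w‖ ^ 2 := by
    intro w hw
    by_cases hw0 : w = 0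
    · rw [hw0, hexp0]
      exact ⟨mem_extChartAt_source x, by simp⟩
    have hwn : 0 < ‖w‖ := norm_pos_iff.2 hw0
    -- A small w ≠ 0 is s • Y with ‖Y‖ = δ and s = ‖w‖ / δ, which turns C * s² into a quadratic
    -- bound in w.
    have hY : ‖(δ / ‖w‖) • w‖ = δ := by
      rw [norm_smul, Real.norm_of_nonneg (by positivity), div_mul_cancel₀ _ hwn.ne']
    have h1 := hC _ hY (‖w‖ / δ) ⟨by positivity, by rw [div_le_one hδ]; exact hw.le⟩
    have h2 : (‖w‖ / δ) • (δ / ‖w‖) • w = w := by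
      rw [smul_smul, div_mul_div_cancel₀ hδ.ne', div_self hwn.ne', one_smul]
    rw [h2] at h1
    refine ⟨h1.1, h1.2.trans_eq ?_⟩
    rw [div_pow]
    ring
  have hev : ∀ᶠ w in 𝓝 (0 : E), ‖w‖ < δ := by
    filter_upwards [Metric.ball_mem_nhds (0 : E) hδ] with w hw
    rwa [mem_ball_zero_iff] at hw
  have hd0 : HasFDerivAt (fun w : E => extChartAt 𝓘(ℝ, E) x (F.exp x w) -
      extChartAt 𝓘(ℝ, E) x x - w) (0 : E →L[ℝ] E) 0 := by
    refine Asymptotics.IsBigO.hasFDerivAt (n := 2) ?_ one_lt_two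
    refine Asymptotics.IsBigO.of_bound (C / δ ^ 2) ?_
    filter_upwards [hev] with w hw
    rw [sub_zero, norm_pow, norm_norm]
    exact (hbound w hw).2
  have hd1 : DifferentiableAt ℝ (fun w : E => extChartAt 𝓘(ℝ, E) x (F.exp x w)) 0 := by
    have h1 := (hd0.differentiableAt.add differentiableAt_id).add_const (extChartAt 𝓘(ℝ, E) x x)
    refine h1.congr_of_eventuallyEq (Eventually.of_forall fun w => ?_)
    simp
  have hsymm : MDifferentiableAt 𝓘(ℝ, E) 𝓘(ℝ, E) (extChartAt 𝓘(ℝ, E) x).symm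
      (extChartAt 𝓘(ℝ, E) x (F.exp x 0)) := by
    rw [hexp0]
    exact ((contMDiffOn_extChartAt_symm (n := ∞) x).contMDiffAt
      (extChartAt_target_mem_nhds x)).mdifferentiableAt (by simp)
  refine (hsymm.comp (0 : E) hd1.mdifferentiableAt).congr_of_eventuallyEq ?_
  filter_upwards [hev] with w hw
  exact ((extChartAt 𝓘(ℝ, E) x).left_inv (hbound w hw).1).symm

/-- The exponential map maps radial vectors to the velocities of the geodesics. -/
theorem dexp_self {x : M} {X : E} {c : ℝ → M} (hc : F.IsUnitTimeGeodesic x X c)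
    (hd : MDifferentiableAt 𝓘(ℝ, E) 𝓘(ℝ, E) (F.exp x) X) :
    (F.dexp x X X : E) = (velocityLift (E := E) c 1).2 := by
  obtain ⟨⟨δ, hδ, hg⟩, hv⟩ := hc
  have h1 : (fun r : ℝ => F.exp x (r • X)) =ᶠ[𝓝 1] c := by
    filter_upwards [Ioo_mem_nhds (zero_lt_one (α := ℝ)) (by linarith : 1 < 1 + δ)] with r hr
    exact exp_smul_eq hδ hg hv hr.1 hr.2
  have h2 := h1.mfderiv_eq (I := 𝓘(ℝ, ℝ)) (I' := 𝓘(ℝ, E))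
  have hs : HasMFDerivAt 𝓘(ℝ, ℝ) 𝓘(ℝ, E) (fun r : ℝ => r • X) 1
      (ContinuousLinearMap.toSpanSingleton ℝ X) :=
    (hasDerivAt_smul_const X).hasFDerivAt.hasMFDerivAt
  have hd' : HasMFDerivAt 𝓘(ℝ, E) 𝓘(ℝ, E) (F.exp x) ((1 : ℝ) • X)
      (mfderiv 𝓘(ℝ, E) 𝓘(ℝ, E) (F.exp x) ((1 : ℝ) • X)) := by
    rw [one_smul]
    exact hd.hasMFDerivAt
  have h3 := (hd'.comp (1 : ℝ) hs).mfderiv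
  have h4 : (mfderiv 𝓘(ℝ, E) 𝓘(ℝ, E) (F.exp x) ((1 : ℝ) • X) X : E) =
      mfderiv 𝓘(ℝ, ℝ) 𝓘(ℝ, E) c 1 (1 : ℝ) := by
    have h5 : ContinuousLinearMap.toSpanSingleton ℝ X (1 : ℝ) = X := by simp
    refine Eq.trans ?_ ((congrArg (fun T : ℝ →L[ℝ] E => T 1) h3).symm.trans
      (congrArg (fun T : ℝ →L[ℝ] E => T 1) h2))
    exact congrArg (mfderiv 𝓘(ℝ, E) 𝓘(ℝ, E) (F.exp x) ((1 : ℝ) • X) : E →L[ℝ] E) h5.symm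
  have h6 : ∀ X' : E, X' = X → (mfderiv 𝓘(ℝ, E) 𝓘(ℝ, E) (F.exp x) X' X : E) = F.dexp x X X := by
    rintro X' rfl
    rfl
  exact (h6 _ (one_smul ℝ X)).symm.trans h4

/-- The first variation formula at time one. -/
theorem velocityPairing_one {c : E → ℝ → M} {x : M} {X : E} (hX : X ≠ 0)
    (hc : ∀ᶠ Y in 𝓝 X, F.IsUnitTimeGeodesic x Y (c Y)) :
    MDifferentiableAt 𝓘(ℝ, E) 𝓘(ℝ, E).tangent (fun Y => velocityLift (E := E) (c Y) 1) X ∧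
      ∀ q, F.velocityPairing c X 1 q = fderiv ℝ (fun Y : E => F ⟨x, Y⟩ ^ 2 / 2) X q := by
  have key := unitInterval_forward_induction (Q := fun t =>
    MDifferentiableAt 𝓘(ℝ, E) 𝓘(ℝ, E).tangent (fun Y => velocityLift (E := E) (c Y) t) X ∧
      ∀ q, F.velocityPairing c X t q = t * fderiv ℝ (fun Y : E => F ⟨x, Y⟩ ^ 2 / 2) X q)
    ⟨mdifferentiableAt_velocityLift_zero hc, fun q => by rw [velocityPairing_zero hc, zero_mul]⟩
    (fun t₀ ht₀ => by
      obtain ⟨η, hη, h⟩ := exists_forward_propagation hX hc ht₀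
      refine ⟨η, hη, fun t₁ ht₁ t₂ ht₂ h₁ h₂ h₁₂ hQ => ?_⟩
      obtain ⟨hd, hq⟩ := h t₁ ht₁ t₂ ht₂ h₁ h₂ h₁₂ hQ.1
      refine ⟨hd, fun q => ?_⟩
      have h3 := hq q
      rw [hQ.2 q] at h3
      linarith)
  exact ⟨key.1, fun q => by rw [key.2 q, one_mul]⟩

end FinslerMetric

/-! ### The Gauss lemma -/

theorem proposition2p7 {E : Type*} [NormedAddCommGroup E] [NormedSpace ℝ E] [FiniteDimensional ℝ E]
    {M : Type*} [TopologicalSpace M] [T2Space M] [ChartedSpace E M] [IsManifold 𝓘(ℝ, E) ∞ M]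
    (F : FinslerMetric E M) (x : M) (ε : ℝ) (hε : F.openIndicatrix x ε ⊆ F.expDomain x)
    (X : TangentSpace 𝓘(ℝ, E) x) (hX : X ∈ F.openIndicatrix x ε) :
    MDifferentiableAt 𝓘(ℝ, E) 𝓘(ℝ, E) (F.exp x) X ∧
      F ⟨x, X⟩ = F ⟨F.exp x X, F.dexp x X X⟩ ∧
      ∀ Y : TangentSpace 𝓘(ℝ, E) x, F.metricTensor x X X Y = 0 →
        F.metricTensor (F.exp x X) (F.dexp x X X) (F.dexp x X X) (F.dexp x X Y) = 0 := by
  by_cases hX0 : X = 0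
  · subst hX0
    have hε0 : 0 < ε := (F.apply_zero x).symm.trans_lt hX
    refine ⟨FinslerMetric.mdifferentiableAt_exp_zero hε0 hε, ?_, fun Y _ => ?_⟩
    -- At X = 0 the differential sends X to 0, and linearity settles both claims, whatever the
    -- default value of the metric tensor at the zero vector.
    · rw [map_zero, F.apply_zero, F.apply_zero]
    · rw [map_zero]
      simp only [map_zero]
      rfl
  have hc : ∀ᶠ Y : E in nhds (X : E), F.IsUnitTimeGeodesic x Y (F.geodesicFamily x Y) := by
    filter_upwards [(F.isOpen_openIndicatrix x ε).mem_nhds hX] with Y hY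
    exact FinslerMetric.isUnitTimeGeodesic_geodesicFamily (hε hY)
  have hcX := hc.self_of_nhds
  obtain ⟨hd, hpair⟩ := FinslerMetric.velocityPairing_one (E := E) hX0 hc
  have hdexp : MDifferentiableAt 𝓘(ℝ, E) 𝓘(ℝ, E) (F.exp x) X :=
    FinslerMetric.mdifferentiableAt_proj_comp hd
  have hself := FinslerMetric.dexp_self hcX hdexp
  have hne : F.dexp x X X ≠ 0 := fun h =>
    hcX.velocity_ne_zero hX0 (t := 1) (by simp) (hself.symm.trans h)
  refine ⟨hdexp, ?_, fun Y hY => ?_⟩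
  · rw [← hcX.speed_eq (t := 1) (by simp)]
    exact congrArg (fun v : E => F ⟨F.exp x X, v⟩) hself.symm
  -- By Euler's relation both orthogonality conditions become the vanishing of an energy
  -- differential, and the first variation formula at time one equates the two.
  · rw [F.metricTensor_self _ _ hne]
    rw [F.metricTensor_self _ _ hX0] at hY
    refine Eq.trans ?_ ((hpair Y).trans hY)
    exact congrArg (fun v : E => fderiv ℝ (fun w : E => F ⟨F.exp x X, w⟩ ^ 2 / 2) v
      (F.dexp x X Y)) hself
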